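/- Let $\Lambda$ be a countable group with $\Lambda\neq\{1\}$, let $H,K\le\Lambda$ be subgroups, let $\phi:H\to K$ be an isomorphism, and let $$\Gamma=HNN(\Lambda,H,K,\phi)=\langle \Lambda,t \mid t^{-1}ht=\phi(h)\ \ (h\in H)\rangle$$ be the HNN extension with stable letter $t$; put $\Gamma_0=\langle t\rangle$. For $j\ge 1$ let $\phi^j$ be the $j$-th power of the partial map $\phi$ of $\Lambda$, with domain $\mathrm{Dom}(\phi)=H$ and $\mathrm{Dom}(\phi^j)=\phi^{-1}(\mathrm{Dom}(\phi^{j-1})\cap K)$ for $j\ge 2$. Suppose that for every $j\geq 1$ the map $\phi^j$ has no nontrivial fixed point, that is, $h\in\mathrm{Dom}(\phi^j)$ and $\phi^j(h)=h$ imply $h=1$. Then: 1. $\Gamma$ is ICC: the conjugacy class of every $g\in\Gamma\setminus\{1\}$ is infinite. 2. The pair $(\Gamma,\Gamma_0)$ satisfies condition (ST): for every finite subset $C\subset\Gamma\setminus\Gamma_0$ there is a finite subset $E\subset\Gamma_0$ such that $g g_0 h\notin\Gamma_0$ for all $g_0\in\Gamma_0\setminus E$ and all $g,h\in C$. 3.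 The group von Neumann algebra $L(\Gamma)$ is a type $\mathrm{II}_1$ factor, and $L(\Gamma_0)$ is strongly mixing in $L(\Gamma)$. Here $L(\Gamma)$ and $L(\Gamma_0)\subset L(\Gamma)$ are the von Neumann algebras on $\ell^2(\Gamma)$ generated by the left regular representation $\lambda$ of $\Gamma$, respectively its restriction to $\Gamma_0$; $\tau(x)=\langle x\delta_1,\delta_1\rangle$ is the canonical trace on $M=L(\Gamma)$, and $\|x\|_2=\tau(x^*x)^{1/2}$. For a von Neumann subalgebra $A\subset M$, $E_A$ is the $\tau$-preserving conditional expectation of $M$ onto $A$. An infinite set $S$ of unitaries of $M$ is *almost orthonormal* if for all $x\in M$ and $\varepsilon>0$ one has $|\tau(ux)|\le\varepsilon$ for all but finitely many $u\in S$. An abelian von Neumann subalgebra $A\subset M$ is *strongly mixing* in $M$ if for every almost orthonormal infinite subgroup $G$ of the unitary group $U(A)$ and all $x,y\in M$, $$\lim_{u\to\infty,\ u\in G}\|E_A(uxu^{-1}y)-E_A(x)E_A(y)\|_2=0,$$ where $u\to\infty$ in $G$ means leaving every finite subset of $G$. -/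

import Mathlib

open Filter Topology
open scoped ENNReal

namespace HNNMixing

/-! ### Groups -/

section Groups

variable {Λ : Type*} [Group Λ] {H K : Subgroup Λ}

/-- The HNN extension `HNN(Λ, H, K, φ)` with the convention `t⁻¹ h t = φ h` for `h ∈ H`
(see `t_inv_mul_of_mul_t`). Mathlib's `HNNExtension G A B ψ` has `t a t⁻¹ = ψ a` for `a ∈ A`, so
it is used with `A = K`, `B = H`, `ψ = φ⁻¹`. -/
abbrev HNN (φ : H ≃* K) : Type _ := HNNExtension Λ K H φ.symm

/-- The stable letter. -/
abbrev stableLetter (φ : H ≃* K) : HNN φ := HNNExtension.t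

theorem t_inv_mul_of_mul_t (φ : H ≃* K) (h : H) :
    (stableLetter φ)⁻¹ * HNNExtension.of (h : Λ) * stableLetter φ
      = HNNExtension.of (φ h : Λ) := by
  have := HNNExtension.equiv_symm_eq_conj (φ := φ.symm) h
  simpa using this.symm

/-- The `j`-th power of the partially defined map `φ : H → K ⊆ Λ`: the element `φʲ x` is defined
for `j ≥ 1` if and only if `x ∈ H` and `φʲ⁻¹` is defined at `φ x`, and then
`φʲ x = φʲ⁻¹ (φ x)`. Thus `y ∈ partialPow φ j x` says that `x ∈ Dom(φʲ)` and `φʲ x = y`. -/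
def partialPow (φ : H ≃* K) : ℕ → Λ → Part Λ
  | 0, x => Part.some x
  | j + 1, x => Part.assert (x ∈ H) fun hx => partialPow φ j (φ ⟨x, hx⟩ : Λ)

/-- Every conjugacy class other than that of the identity is infinite. -/
def IsICC (Γ : Type*) [Group Γ] : Prop :=
  ∀ g : Γ, g ≠ 1 → {x : Γ | ∃ h : Γ, x = h * g * h⁻¹}.Infinite

/-- Condition (ST) for a pair of groups `Γ₀ ≤ Γ`. -/
def ConditionST {Γ : Type*} [Group Γ] (Γ₀ : Subgroup Γ) : Prop :=
  ∀ C : Finset Γ, (∀ c ∈ C, c ∉ Γ₀) →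
    ∃ E : Finset Γ, (∀ e ∈ E, e ∈ Γ₀) ∧
      ∀ g₀ ∈ Γ₀, g₀ ∉ E → ∀ g ∈ C, ∀ h ∈ C, g * g₀ * h ∉ Γ₀

end Groups

/-! ### Von Neumann algebras -/

section VonNeumann

variable {𝓗 : Type*} [NormedAddCommGroup 𝓗] [InnerProductSpace ℂ 𝓗] [CompleteSpace 𝓗]

/-- The von Neumann algebra generated by a set `S` of bounded operators: the double commutant of
`S ∪ S*` (`StarSubalgebra.centralizer ℂ S` is the commutant of `S ∪ S*`). -/
noncomputable def generatedVN (S : Set (𝓗 →L[ℂ] 𝓗)) : VonNeumannAlgebra 𝓗 where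
  toStarSubalgebra :=
    StarSubalgebra.centralizer ℂ (StarSubalgebra.centralizer ℂ S : Set (𝓗 →L[ℂ] 𝓗))
  centralizer_centralizer' := by simp

theorem subset_generatedVN (S : Set (𝓗 →L[ℂ] 𝓗)) :
    S ⊆ (generatedVN S : Set (𝓗 →L[ℂ] 𝓗)) := by
  intro x hx
  change x ∈ StarSubalgebra.centralizer ℂ (StarSubalgebra.centralizer ℂ S : Set (𝓗 →L[ℂ] 𝓗))
  rw [StarSubalgebra.mem_centralizer_iff]
  intro g hg
  have hg' := (StarSubalgebra.mem_centralizer_iff ℂ).1 hg x hx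
  have hg'' := (StarSubalgebra.mem_centralizer_iff ℂ).1
    (star_mem (S := StarSubalgebra ℂ (𝓗 →L[ℂ] 𝓗)) hg) x hx
  exact ⟨hg'.1.symm, hg''.1.symm⟩

/-- The generated von Neumann algebra is the smallest one that contains `S`. -/
theorem generatedVN_le {S : Set (𝓗 →L[ℂ] 𝓗)} {N : VonNeumannAlgebra 𝓗}
    (h : S ⊆ (N : Set (𝓗 →L[ℂ] 𝓗))) : generatedVN S ≤ N := by
  intro x hx
  change x ∈ StarSubalgebra.centralizer ℂ
    (StarSubalgebra.centralizer ℂ S : Set (𝓗 →L[ℂ] 𝓗)) at hx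
  rw [← N.commutant_commutant, VonNeumannAlgebra.mem_commutant_iff]
  intro g hg
  rw [VonNeumannAlgebra.mem_commutant_iff] at hg
  refine ((StarSubalgebra.mem_centralizer_iff ℂ).1 hx g ?_).1
  refine (StarSubalgebra.mem_centralizer_iff ℂ).2 fun s hs => ⟨hg s (h hs), ?_⟩
  exact hg _ (star_mem (S := VonNeumannAlgebra 𝓗) (h hs))

/-- `M` is a factor: it is non-zero and its center consists of the scalars. -/
def IsFactor (M : VonNeumannAlgebra 𝓗) : Prop :=
  (1 : 𝓗 →L[ℂ] 𝓗) ≠ 0 ∧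
    ∀ z : 𝓗 →L[ℂ] 𝓗, z ∈ M → (∀ x ∈ M, z * x = x * z) → ∃ c : ℂ, z = c • 1

/-- `M` is finite: every isometry in `M` is unitary. -/
def IsFiniteVN (M : VonNeumannAlgebra 𝓗) : Prop :=
  ∀ v ∈ M, star v * v = 1 → v * star v = 1

/-- `p` is an abelian projection of `M`: a projection in `M` such that `pMp` is commutative. -/
def IsAbelianProjection (M : VonNeumannAlgebra 𝓗) (p : 𝓗 →L[ℂ] 𝓗) : Prop :=
  p ∈ M ∧ IsStarProjection p ∧
    ∀ x ∈ M, ∀ y ∈ M, (p * x * p) * (p * y * p) = (p * y * p) * (p * x * p)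

/-- `M` is a factor of type II₁: a finite factor without non-zero abelian projections. -/
def IsTypeII₁Factor (M : VonNeumannAlgebra 𝓗) : Prop :=
  IsFactor M ∧ IsFiniteVN M ∧ ∀ p, IsAbelianProjection M p → p = 0

/-- The norm `‖x‖₂ = τ(x* x)^{1/2}` of a trace `τ`. -/
noncomputable def twoNorm (τ : (𝓗 →L[ℂ] 𝓗) → ℂ) (x : 𝓗 →L[ℂ] 𝓗) : ℝ :=
  √(τ (star x * x)).re

/-- `E` is the `τ`-preserving conditional expectation of `M` onto `A`, through its
characterization `E x ∈ A` and `τ(E(x) b) = τ(x b)` for all `x ∈ M` and `b ∈ A`. As the trace `τ`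
is faithful on `A`, this determines `E` on `M`; the values of `E` off `M` are irrelevant. -/
def IsCondExp (τ : (𝓗 →L[ℂ] 𝓗) → ℂ) (M A : VonNeumannAlgebra 𝓗)
    (E : (𝓗 →L[ℂ] 𝓗) → (𝓗 →L[ℂ] 𝓗)) : Prop :=
  ∀ x ∈ M, E x ∈ A ∧ ∀ b ∈ A, τ (E x * b) = τ (x * b)

/-- A set `S` of unitaries of `M` is almost orthonormal: it is infinite and for every `x ∈ M` and
`ε > 0`, one has `|τ(u x)| ≤ ε` for all but finitely many `u ∈ S`. -/
def IsAlmostOrthonormal (τ : (𝓗 →L[ℂ] 𝓗) → ℂ) (M : VonNeumannAlgebra 𝓗)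
    (S : Set (unitary (𝓗 →L[ℂ] 𝓗))) : Prop :=
  S.Infinite ∧ ∀ x ∈ M, ∀ ε : ℝ, 0 < ε → {u ∈ S | ¬ ‖τ ((u : 𝓗 →L[ℂ] 𝓗) * x)‖ ≤ ε}.Finite

/-- The von Neumann subalgebra `A ⊆ M` is strongly mixing in `M` (with trace `τ`): it is abelian,
and for every almost orthonormal infinite subgroup `G` of the unitary group `U(A)` and all
`x, y ∈ M`, `‖E_A(u x u⁻¹ y) - E_A(x) E_A(y)‖₂ → 0` as `u → ∞` in `G`, that is, along the
complements of the finite subsets of `G`. The existence of the conditional expectation `E_A` is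
asserted. -/
def IsStronglyMixing (τ : (𝓗 →L[ℂ] 𝓗) → ℂ) (M A : VonNeumannAlgebra 𝓗) : Prop :=
  A ≤ M ∧ (∀ a ∈ A, ∀ b ∈ A, a * b = b * a) ∧
    ∃ E : (𝓗 →L[ℂ] 𝓗) → (𝓗 →L[ℂ] 𝓗), IsCondExp τ M A E ∧
      ∀ G : Subgroup (unitary (𝓗 →L[ℂ] 𝓗)), (∀ u ∈ G, (u : 𝓗 →L[ℂ] 𝓗) ∈ A) →
        IsAlmostOrthonormal τ M (G : Set (unitary (𝓗 →L[ℂ] 𝓗))) →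
          ∀ x ∈ M, ∀ y ∈ M,
            Tendsto (fun u : G => twoNorm τ
                (E ((u : 𝓗 →L[ℂ] 𝓗) * x * ((u⁻¹ : G) : 𝓗 →L[ℂ] 𝓗) * y) - E x * E y))
              cofinite (𝓝 0)

end VonNeumann

/-! ### Group von Neumann algebras -/

section GroupVN

variable (Γ : Type*) [Group Γ]

/-- The Hilbert space `ℓ²(Γ)`. -/
abbrev ell2 : Type _ := lp (fun _ : Γ => ℂ) 2

variable {Γ}

/-- The left regular representation as isometries, `(λ(g) ξ)(h) = ξ(g⁻¹ h)`. -/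
noncomputable def leftRegIsometry (g : Γ) : ell2 Γ →ₗᵢ[ℂ] ell2 Γ where
  toFun ξ := ⟨fun h => ξ (g⁻¹ * h), by
    have h2 : 0 < (2 : ℝ≥0∞).toReal := by norm_num
    have h1 := (memℓp_gen_iff h2).1 (lp.memℓp ξ)
    exact (memℓp_gen_iff h2).2 ((Equiv.mulLeft g⁻¹).summable_iff.2 h1)⟩
  map_add' _ _ := by ext; rfl
  map_smul' _ _ := by ext; rfl
  norm_map' ξ := by
    have h2 : 0 < (2 : ℝ≥0∞).toReal := by norm_num
    rw [lp.norm_eq_tsum_rpow h2, lp.norm_eq_tsum_rpow h2]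
    congr 1
    exact (Equiv.mulLeft g⁻¹).tsum_eq (fun h => ‖ξ h‖ ^ (2 : ℝ≥0∞).toReal)

/-- The left regular representation `λ` of `Γ` on `ℓ²(Γ)`. -/
noncomputable def leftReg (g : Γ) : ell2 Γ →L[ℂ] ell2 Γ :=
  (leftRegIsometry g).toContinuousLinearMap

theorem leftReg_apply (g h : Γ) (ξ : ell2 Γ) : leftReg g ξ h = ξ (g⁻¹ * h) := rfl

/-- For a subgroup `Γ₀` of `Γ`, the von Neumann algebra `L(Γ₀)` on `ℓ²(Γ)` generated by the
unitaries `λ(g)`, `g ∈ Γ₀`. -/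
noncomputable def subgroupVN (Γ₀ : Subgroup Γ) : VonNeumannAlgebra (ell2 Γ) :=
  generatedVN (leftReg '' (Γ₀ : Set Γ))

variable (Γ) in
/-- The group von Neumann algebra `L(Γ)`. -/
noncomputable def groupVN : VonNeumannAlgebra (ell2 Γ) := generatedVN (Set.range leftReg)

open Classical in
/-- The vector `δ₁` of `ℓ²(Γ)`. -/
noncomputable def deltaOne : ell2 Γ := lp.single 2 (1 : Γ) (1 : ℂ)

/-- The canonical trace `τ(x) = ⟨x δ₁, δ₁⟩` (Mathlib's inner product is conjugate linear in its
first variable). -/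
noncomputable def canonicalTrace (x : ell2 Γ →L[ℂ] ell2 Γ) : ℂ :=
  inner ℂ (deltaOne : ell2 Γ) (x deltaOne)

end GroupVN

end HNNMixing

/-! The group input is that `g tⁿ g⁻¹ ∈ ⟨t⟩` with `n ≠ 0` forces `g ∈ ⟨t⟩`
(`mem_zpowers_of_conj_zpow_eq`). The exponent of `t` is a conjugacy invariant, so `g` commutes with
`tⁿ`. Induct on the length of a reduced word for `g`. If neither end cancels against powers of `t`,
conjugation by a positive power lengthens the word, contradicting Britton's lemma; if an end
cancels, multiplication by `t` or `t⁻¹` at that end shortens it. Length zero leaves `a ∈ Λ` fixed by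
a power of `φ`, so `a = 1`. Both (ST) and the ICC property follow.

On the analytic side, `L(Γ₀)` is the set of bounded left convolution operators supported on `Γ₀`
(`mem_subgroupVN_iff`), so an element of `L(Γ)` is determined by its value at `δ₁`. ICC leaves only
multiples of `δ₁` among square summable class functions, which gives a trivial center. It also shows
that a nonzero abelian projection `p` would satisfy `p λ(g) p ∈ ℂ p` for all `g`, which an
orthogonality estimate excludes in an infinite group.

For strong mixing, subtract `E(x)` from `x`; commutativity of `L(Γ₀)` reduces the claim to showing
that the projection of `w u* y δ₁` to `ℓ²(Γ₀)` tends to `0` when `E(w) = 0`. By (ST), for `w = λ(g)`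
with `g ∉ Γ₀` and `y = λ(h)`, this projection involves finitely many coefficients of `u*`, each
tending to `0`; the general case follows by approximation (`ConditionST.tendsto_norm_mask`). -/

namespace HNNMixing

/-! ### Reduced words in the HNN extension and centralizers of powers of `t`. -/

section HNNGroups

open HNNExtension HNNExtension.NormalWord

variable {Λ : Type*} [Group Λ] {H K : Subgroup Λ}

/-- The homomorphism `HNN(Λ, H, K, φ) → ℤ` that kills `Λ` and sends the stable letter to `1`. -/
noncomputable def exponentHom (φ : H ≃* K) : HNN φ →* Multiplicative ℤ :=
  HNNExtension.lift 1 (Multiplicative.ofAdd 1) (by simp)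

theorem exponentHom_t_zpow (φ : H ≃* K) (n : ℤ) :
    exponentHom φ (stableLetter φ ^ n) = Multiplicative.ofAdd n := by
  rw [map_zpow, exponentHom, HNNExtension.lift_t, ← ofAdd_zsmul, smul_eq_mul, mul_one]

theorem exponentHom_of (φ : H ≃* K) (a : Λ) :
    exponentHom φ (HNNExtension.of a) = 1 := by
  simp [exponentHom]

/-- The homomorphism `exponentHom` has commutative target, hence is blind to conjugation. -/
theorem eq_of_conj_t_zpow (φ : H ≃* K) {g : HNN φ} {n m : ℤ}
    (h : g * stableLetter φ ^ n * g⁻¹ = stableLetter φ ^ m) : n = m := by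
  have h' := congrArg (exponentHom φ) h
  rw [map_mul, map_mul, exponentHom_t_zpow, exponentHom_t_zpow, mul_comm (exponentHom φ g),
    mul_assoc, ← map_mul, mul_inv_cancel, map_one, mul_one] at h'
  exact Multiplicative.ofAdd.injective h'

/-- Equal consecutive signs never cancel, so only the junction with the appended power of `t` needs
a hypothesis. -/
theorem isChain_append_replicate {l : List (ℤˣ × Λ)} {u : ℤˣ}
    (hl : l.IsChain (fun a b => a.2 ∈ toSubgroup K H a.1 → a.1 = b.1))
    (hlast : ∀ x ∈ l.getLast?, x.2 ∈ toSubgroup K H x.1 → x.1 = u) (k : ℕ) :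
    (l ++ List.replicate k (u, (1 : Λ))).IsChain
      (fun a b => a.2 ∈ toSubgroup K H a.1 → a.1 = b.1) := by
  rw [List.isChain_append]
  refine ⟨hl, List.isChain_replicate_of_rel _ fun _ => rfl, ?_⟩
  intro x hx y hy
  have : y = (u, 1) := List.eq_of_mem_replicate (List.mem_of_mem_head? hy)
  subst this
  exact hlast x hx

/-- If neither end of the reduced word `w` cancels against powers of `t`, then `t⁻ᵏ w tᵏ` is again
reduced. -/
theorem exists_reducedWord_conj (φ : H ≃* K) (w : ReducedWord Λ K H) (k : ℕ)
    (hfirst : ∀ x ∈ w.toList.head?, w.head ∈ H → x.1 = -1)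
    (hnil : w.toList = [] → w.head ∉ H)
    (hlast : ∀ x ∈ w.toList.getLast?, x.2 ∈ toSubgroup K H x.1 → x.1 = 1) :
    ∃ w' : ReducedWord Λ K H,
      w'.prod φ.symm = (stableLetter φ ^ (k + 1))⁻¹ * w.prod φ.symm * stableLetter φ ^ (k + 1) ∧
      w'.toList.length = w.toList.length + 2 * (k + 1) := by
  have hc := isChain_append_replicate w.chain hlast (k + 1)
  have hc' : ((-1, w.head) :: (w.toList ++ List.replicate (k + 1) ((1 : ℤˣ), (1 : Λ)))).IsChain
      (fun a b => a.2 ∈ toSubgroup K H a.1 → a.1 = b.1) := by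
    rw [List.isChain_cons]
    refine ⟨?_, hc⟩
    intro y hy hw
    rcases hl : w.toList with _ | ⟨x, l⟩
    · exact absurd hw (hnil hl)
    · rw [hl] at hy hfirst
      simp only [List.cons_append, List.head?_cons, Option.mem_def, Option.some.injEq] at hy
      subst hy
      exact (hfirst x (by simp) hw).symm
  -- The last of the `k + 1` letters `t⁻¹` on the left carries the head of `w`; hence only `k`
  -- copies of `(-1, 1)`.
  refine ⟨⟨1, List.replicate k ((-1 : ℤˣ), (1 : Λ)) ++
    (-1, w.head) :: (w.toList ++ List.replicate (k + 1) ((1 : ℤˣ), (1 : Λ))), ?_⟩, ?_, ?_⟩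
  · rw [List.isChain_append]
    refine ⟨List.isChain_replicate_of_rel _ fun _ => rfl, hc', ?_⟩
    intro x hx y hy _
    have : x = (-1, 1) := List.eq_of_mem_replicate (List.mem_of_mem_getLast? hx)
    subst this
    simp only [List.head?_cons, Option.mem_def, Option.some.injEq] at hy
    subst hy
    rfl
  · simp [ReducedWord.prod, pow_succ', mul_assoc]
  · simp; ring

/-- Reducedness constrains a group entry only when another letter follows it, so the final entry may
be changed freely. -/
theorem exists_reducedWord_mul_of (φ : H ≃* K) (w : ReducedWord Λ K H) (a : Λ) :
    ∃ w' : ReducedWord Λ K H, w'.prod φ.symm = w.prod φ.symm * HNNExtension.of a ∧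
      w'.toList.length = w.toList.length := by
  rcases w with ⟨c, l, hl⟩
  rcases List.eq_nil_or_concat l with rfl | ⟨l, x, rfl⟩
  · exact ⟨⟨c * a, [], List.isChain_nil⟩, by simp [ReducedWord.prod]⟩
  · simp only [List.concat_eq_append] at hl ⊢
    refine ⟨⟨c, l ++ [(x.1, x.2 * a)], ?_⟩, by simp [ReducedWord.prod, mul_assoc], by simp⟩
    rw [List.isChain_append] at hl ⊢
    refine ⟨hl.1, List.isChain_singleton _, fun y hy z hz => ?_⟩
    simp only [List.head?_cons, Option.mem_def, Option.some.injEq] at hz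
    subst hz
    exact hl.2.2 y hy x (by simp)

theorem exists_reducedWord_prod_eq (φ : H ≃* K) (g : HNN φ) :
    ∃ w : ReducedWord Λ K H, w.prod φ.symm = g := by
  obtain ⟨d⟩ := TransversalPair.nonempty Λ K H
  exact ⟨(HNNExtension.NormalWord.equiv φ.symm d g).toReducedWord,
    (HNNExtension.NormalWord.equiv φ.symm d).symm_apply_apply g⟩

/-- Britton's lemma: the sequence of signs of a reduced word depends only on its product. -/
theorem length_eq_of_prod_eq (φ : H ≃* K) {w₁ w₂ : ReducedWord Λ K H}
    (h : w₁.prod φ.symm = w₂.prod φ.symm) : w₁.toList.length = w₂.toList.length := by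
  simpa using congrArg List.length (ReducedWord.map_fst_eq_and_of_prod_eq φ.symm h).1

/-- If `t⁻ʲ a tʲ = b` for `a, b ∈ Λ`, then `φʲ` is defined at `a` with value `b`. -/
theorem mem_partialPow_of_conj_eq (φ : H ≃* K) (j : ℕ) : ∀ a b : Λ,
    (stableLetter φ ^ j)⁻¹ * HNNExtension.of a * stableLetter φ ^ j = HNNExtension.of b →
      b ∈ partialPow φ j a := by
  induction j with
  | zero =>
    intro a b h
    have : a = b := HNNExtension.of_injective φ.symm (by simpa using h)
    simp [partialPow, this]
  | succ j ih =>
    intro a b h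
    have ha : a ∈ H := by
      by_contra ha
      -- For `a ∉ H` the conjugate has a reduced word with `2(j + 1)` letters, whereas `b` has none.
      obtain ⟨w', hw', hl⟩ := exists_reducedWord_conj φ ⟨a, [], List.isChain_nil⟩ j
        (by simp) (fun _ => ha) (by simp)
      have := length_eq_of_prod_eq φ (w₁ := w') (w₂ := ⟨b, [], List.isChain_nil⟩)
        (by rw [hw']; simpa [ReducedWord.prod] using h)
      rw [hl] at this
      simp at this
    have := ih (φ ⟨a, ha⟩) b (by
      rw [← t_inv_mul_of_mul_t, ← h]
      simp only [pow_succ', mul_inv_rev, mul_assoc])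
    simpa [partialPow, Part.mem_assert_iff, ha] using this

/-- If no positive power of `φ` has a nontrivial fixed point, then the centralizer of every
nontrivial power of `t` is `⟨t⟩`. -/
theorem mem_zpowers_of_commute_pow (φ : H ≃* K)
    (hφ : ∀ j : ℕ, 1 ≤ j → ∀ h : Λ, h ∈ partialPow φ j h → h = 1) (k : ℕ) (n : ℕ) :
    ∀ w : ReducedWord Λ K H, w.toList.length = n →
      Commute (w.prod φ.symm) (stableLetter φ ^ (k + 1)) →
      w.prod φ.symm ∈ Subgroup.zpowers (stableLetter φ) := by
  induction n with
  | zero =>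
    rintro ⟨a, l, hl⟩ hn hc
    obtain rfl := List.eq_nil_of_length_eq_zero hn
    have hp : ReducedWord.prod φ.symm ⟨a, [], hl⟩ = HNNExtension.of a := by
      simp [ReducedWord.prod]
    rw [hp] at hc ⊢
    have ha := hφ (k + 1) (by omega) a (mem_partialPow_of_conj_eq φ (k + 1) a a (by
      rw [mul_assoc, hc.eq, inv_mul_cancel_left]))
    rw [ha, map_one]
    exact one_mem _
  | succ n ih =>
    intro w hn hc
    have hcomm : Commute (stableLetter φ) (stableLetter φ ^ (k + 1)) := Commute.self_pow _ _
    have ht := Subgroup.mem_zpowers (stableLetter φ)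
    by_cases hfirst : ∀ x ∈ w.toList.head?, w.head ∈ H → x.1 = -1
    · by_cases hlast : ∀ x ∈ w.toList.getLast?, x.2 ∈ toSubgroup K H x.1 → x.1 = 1
      -- No cancellation at either end: `w` and its longer conjugate would represent the same
      -- element.
      · obtain ⟨w', hw', hl⟩ := exists_reducedWord_conj φ w k hfirst
          (fun h => by simp [h] at hn) hlast
        have := length_eq_of_prod_eq φ (w₁ := w') (w₂ := w)
          (by rw [hw', mul_assoc, hc.eq, inv_mul_cancel_left])
        omega
      · push Not at hlast
        obtain ⟨⟨u, a⟩, hx, hxm, hu⟩ := hlast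
        obtain rfl : u = -1 := (Int.units_eq_one_or u).resolve_left hu
        obtain ⟨l, hl⟩ : ∃ l, w.toList = l ++ [(-1, a)] := by
          rw [Option.mem_def, List.getLast?_eq_some_iff] at hx
          exact hx
        have hchain := w.chain
        rw [hl, List.isChain_append] at hchain
        have haH : a ∈ H := hxm
        -- Here `w = l t⁻¹ a` with `a ∈ H`, so `w t = l φ(a)` is one letter shorter and still
        -- commutes with the power of `t`.
        obtain ⟨w', hw', hlen⟩ := exists_reducedWord_mul_of φ ⟨w.head, l, hchain.1⟩
          (φ ⟨a, haH⟩)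
        have hprod : w'.prod φ.symm = w.prod φ.symm * stableLetter φ := by
          rw [hw', ← t_inv_mul_of_mul_t]
          simp [ReducedWord.prod, hl, mul_assoc]
        have := ih w' (by rw [hlen]; simpa [hl] using hn)
          (by rw [hprod]; exact hc.mul_left hcomm)
        rw [hprod] at this
        exact (Subgroup.mul_mem_cancel_right _ ht).1 this
    · push Not at hfirst
      obtain ⟨⟨u, b⟩, hx, hH, hu⟩ := hfirst
      obtain rfl : u = 1 := by
        rcases Int.units_eq_one_or u with h | h
        · exact h
        · exact absurd h hu
      obtain ⟨l, hl⟩ : ∃ l, w.toList = (1, b) :: l := by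
        rw [Option.mem_def, List.head?_eq_some_iff] at hx
        exact hx
      have hchain := w.chain
      rw [hl, List.isChain_cons] at hchain
      -- Here `w = h t b ⋯` with `h ∈ H`, so `t⁻¹ w = φ(h) b ⋯` is one letter shorter.
      have hprod : ReducedWord.prod φ.symm ⟨φ ⟨w.head, hH⟩ * b, l, hchain.2⟩ =
          (stableLetter φ)⁻¹ * w.prod φ.symm := by
        have := t_inv_mul_of_mul_t φ ⟨w.head, hH⟩
        simp only [ReducedWord.prod, map_mul, ← this, hl]
        simp [mul_assoc]
      have := ih ⟨φ ⟨w.head, hH⟩ * b, l, hchain.2⟩ (by simpa [hl] using hn)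
        (by rw [hprod]; exact hcomm.inv_left.mul_left hc)
      rw [hprod] at this
      exact (Subgroup.mul_mem_cancel_left _ (inv_mem ht)).1 this

theorem mem_zpowers_of_conj_zpow_eq (φ : H ≃* K)
    (hφ : ∀ j : ℕ, 1 ≤ j → ∀ h : Λ, h ∈ partialPow φ j h → h = 1) {g : HNN φ} {n m : ℤ}
    (hn : n ≠ 0) (h : g * stableLetter φ ^ n * g⁻¹ = stableLetter φ ^ m) :
    g ∈ Subgroup.zpowers (stableLetter φ) := by
  obtain rfl := eq_of_conj_t_zpow φ h
  have hc : Commute g (stableLetter φ ^ n) := by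
    rw [commute_iff_eq]
    exact mul_inv_eq_iff_eq_mul.1 h
  obtain ⟨w, rfl⟩ := exists_reducedWord_prod_eq φ g
  obtain ⟨k, hk⟩ := Nat.exists_eq_succ_of_ne_zero (Int.natAbs_ne_zero.2 hn)
  refine mem_zpowers_of_commute_pow φ hφ k _ w rfl ?_
  rw [← Nat.succ_eq_add_one, ← hk, ← zpow_natCast]
  rcases Int.natAbs_eq n with h' | h'
  · rwa [← h']
  · have : ((n.natAbs : ℕ) : ℤ) = -n := by omega
    rw [this, zpow_neg]
    exact hc.inv_right

/-- Each pair `g, h ∈ C` excludes at most one power of `t`: two of them, `tⁿ` and `tⁿ'`, would give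
`g tⁿ⁻ⁿ' g⁻¹ ∈ ⟨t⟩`, hence `g ∈ ⟨t⟩`. -/
theorem conditionST_zpowers_stableLetter (φ : H ≃* K)
    (hφ : ∀ j : ℕ, 1 ≤ j → ∀ h : Λ, h ∈ partialPow φ j h → h = 1) :
    ConditionST (Subgroup.zpowers (stableLetter φ)) := by
  intro C hC
  have hfin : {e | e ∈ Subgroup.zpowers (stableLetter φ) ∧
      ∃ g ∈ C, ∃ h ∈ C, g * e * h ∈ Subgroup.zpowers (stableLetter φ)}.Finite := by
    have : {e | e ∈ Subgroup.zpowers (stableLetter φ) ∧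
        ∃ g ∈ C, ∃ h ∈ C, g * e * h ∈ Subgroup.zpowers (stableLetter φ)} ⊆
        ⋃ g ∈ (C : Set (HNN φ)), ⋃ h ∈ (C : Set (HNN φ)),
          {e | e ∈ Subgroup.zpowers (stableLetter φ) ∧
            g * e * h ∈ Subgroup.zpowers (stableLetter φ)} := by
      rintro e ⟨he, g, hg, h, hh, hm⟩
      simp only [Set.mem_iUnion]
      exact ⟨g, hg, h, hh, he, hm⟩
    refine Set.Finite.subset ?_ this
    refine C.finite_toSet.biUnion fun g hg => C.finite_toSet.biUnion fun h _ => ?_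
    refine Set.Subsingleton.finite ?_
    rintro _ ⟨⟨n, rfl⟩, ⟨m, hm⟩⟩ _ ⟨⟨n', rfl⟩, ⟨m', hm'⟩⟩
    by_contra hne
    refine hC g hg (mem_zpowers_of_conj_zpow_eq φ hφ (n := n - n') (m := m - m') ?_ ?_)
    · rintro h0
      exact hne (by rw [sub_eq_zero.1 h0])
    · simp only at hm hm'
      rw [zpow_sub, zpow_sub, hm, hm']
      group
  refine ⟨hfin.toFinset, fun e he => ((Set.Finite.mem_toFinset _).1 he).1, ?_⟩
  intro e he hne g hg h hh hm
  exact hne ((Set.Finite.mem_toFinset _).2 ⟨he, g, hg, h, hh, hm⟩)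

/-- Outside `⟨t⟩` the conjugates by powers of `t` are distinct. A nontrivial power of `t` is first
moved out of `⟨t⟩` by conjugating with some `a ≠ 1` in `Λ`. -/
theorem isICC_HNN [Nontrivial Λ] (φ : H ≃* K)
    (hφ : ∀ j : ℕ, 1 ≤ j → ∀ h : Λ, h ∈ partialPow φ j h → h = 1) : IsICC (HNN φ) := by
  have key : ∀ g : HNN φ, g ∉ Subgroup.zpowers (stableLetter φ) →
      {x : HNN φ | ∃ h : HNN φ, x = h * g * h⁻¹}.Infinite := by
    intro g hg
    refine Set.infinite_of_injective_forall_mem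
      (f := fun n : ℤ => stableLetter φ ^ n * g * (stableLetter φ ^ n)⁻¹) ?_ fun n => ⟨_, rfl⟩
    intro n m hnm
    by_contra hne
    refine hg (mem_zpowers_of_conj_zpow_eq φ hφ (n := n - m) (m := n - m)
      (sub_ne_zero.2 hne) ?_)
    simp only at hnm
    have h1 : g = stableLetter φ ^ (n - m) * g * (stableLetter φ ^ (n - m))⁻¹ := by
      calc g = (stableLetter φ ^ m)⁻¹ * (stableLetter φ ^ m * g * (stableLetter φ ^ m)⁻¹) *
            stableLetter φ ^ m := by group
        _ = _ := by rw [← hnm]; group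
    rw [mul_inv_eq_iff_eq_mul]
    exact eq_mul_inv_iff_mul_eq.1 h1
  intro g hg
  by_cases hgt : g ∈ Subgroup.zpowers (stableLetter φ)
  · obtain ⟨n, rfl⟩ := hgt
    obtain ⟨a, ha⟩ := exists_ne (1 : Λ)
    have hn : n ≠ 0 := by
      rintro rfl
      simp at hg
    have hmem : (HNNExtension.of a : HNN φ) ∉ Subgroup.zpowers (stableLetter φ) := by
      rintro ⟨m, hm⟩
      simp only at hm
      have h0 := congrArg (exponentHom φ) hm
      rw [exponentHom_t_zpow, exponentHom_of, ofAdd_eq_one] at h0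
      rw [h0, zpow_zero, eq_comm, map_eq_one_iff _ (HNNExtension.of_injective φ.symm)] at hm
      exact ha hm
    have hconj := key (HNNExtension.of a * stableLetter φ ^ n * (HNNExtension.of a)⁻¹) (by
      rintro ⟨m, hm⟩
      exact hmem (mem_zpowers_of_conj_zpow_eq φ hφ hn hm.symm))
    refine hconj.mono ?_
    rintro _ ⟨h, rfl⟩
    exact ⟨h * HNNExtension.of a, by simp only [mul_inv_rev, mul_assoc]⟩
  · exact key g hgt

end HNNGroups

/-! ### Matrix coefficients and block compressions on `ℓ²(Γ)`. -/

section EllTwo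

variable {Γ : Type*}

theorem two_toReal_pos : 0 < (2 : ℝ≥0∞).toReal := by norm_num

theorem ell2_hasSum_sq (ξ : ell2 Γ) : HasSum (fun k => ‖ξ k‖ ^ 2) (‖ξ‖ ^ 2) := by
  have := lp.hasSum_norm two_toReal_pos ξ
  simpa using this

theorem ell2_sum_sq_le (ξ : ell2 Γ) (s : Finset Γ) : ∑ k ∈ s, ‖ξ k‖ ^ 2 ≤ ‖ξ‖ ^ 2 :=
  sum_le_hasSum s (fun _ _ => by positivity) (ell2_hasSum_sq ξ)

theorem ell2_tendsto_cofinite (ξ : ell2 Γ) : Tendsto (fun k => ‖ξ k‖) cofinite (𝓝 0) := by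
  have h := (ell2_hasSum_sq ξ).summable.tendsto_cofinite_zero
  have := h.sqrt
  simpa [Real.sqrt_sq] using this

theorem memℓp_two_of_sum_sq_le {f : Γ → ℂ} {C : ℝ}
    (h : ∀ s : Finset Γ, ∑ k ∈ s, ‖f k‖ ^ 2 ≤ C) : Memℓp f 2 :=
  memℓp_gen' (C := C) (by simpa using h)

theorem ell2_norm_le_of_sum_sq_le {ξ : ell2 Γ} {C : ℝ} (hC : 0 ≤ C)
    (h : ∀ s : Finset Γ, ∑ k ∈ s, ‖ξ k‖ ^ 2 ≤ C ^ 2) : ‖ξ‖ ≤ C :=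
  lp.norm_le_of_forall_sum_le two_toReal_pos hC (by simpa using h)

open Classical in
/-- The vector `δ_g` of `ℓ²(Γ)`. -/
noncomputable def delta (g : Γ) : ell2 Γ := lp.single 2 g (1 : ℂ)

open Classical in
theorem delta_apply (g k : Γ) : delta g k = if k = g then (1 : ℂ) else 0 := by
  simp only [delta, lp.coeFn_single, Pi.single_apply]

theorem delta_apply_congr {a b c d : Γ} (h : a = b ↔ c = d) : delta b a = delta d c := by
  classical
  rw [delta_apply, delta_apply]
  exact if_congr h rfl rfl

theorem star_delta_apply (a b : Γ) : star (delta a b) = delta a b := by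
  classical
  rw [delta_apply]
  split_ifs
  · exact star_one ℂ
  · exact star_zero ℂ

theorem inner_delta_left (g : Γ) (ξ : ell2 Γ) : inner ℂ (delta g) ξ = ξ g := by
  classical
  simp [delta, lp.inner_single_left]

theorem norm_delta (g : Γ) : ‖delta g‖ = 1 := by
  classical
  simp [delta, lp.norm_single]

theorem hasSum_delta (ξ : ell2 Γ) : HasSum (fun k => ξ k • delta k) ξ := by
  classical
  have := lp.hasSum_single (p := 2) (by norm_num) ξ
  refine this.congr_fun ?_ |> fun h => h
  intro k
  rw [delta, ← lp.single_smul, smul_eq_mul, mul_one]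

theorem clm_ext_delta {S T : ell2 Γ →L[ℂ] ell2 Γ} (h : ∀ g, S (delta g) = T (delta g)) :
    S = T := by
  ext1 ξ
  refine ((hasSum_delta ξ).mapL S).unique ?_
  convert (hasSum_delta ξ).mapL T using 2 with k
  rw [map_smul, map_smul, h]

theorem star_apply_delta (X : ell2 Γ →L[ℂ] ell2 Γ) (h k : Γ) :
    star X (delta h) k = star (X (delta k) h) := by
  rw [← inner_delta_left, ContinuousLinearMap.star_eq_adjoint,
    ContinuousLinearMap.adjoint_inner_right, ← inner_conj_symm, inner_delta_left]
  rfl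

/-- Row `k` of the matrix of `X` is the conjugate of `star X (delta k)`, hence square summable; the
series is an inner product. -/
theorem hasSum_apply (X : ell2 Γ →L[ℂ] ell2 Γ) (ξ : ell2 Γ) (k : Γ) :
    HasSum (fun h => X (delta h) k * ξ h) (X ξ k) := by
  have := lp.hasSum_inner (𝕜 := ℂ) (star X (delta k)) ξ
  rw [ContinuousLinearMap.star_eq_adjoint, ContinuousLinearMap.adjoint_inner_left,
    inner_delta_left] at this
  have heq : (fun i => inner ℂ (ContinuousLinearMap.adjoint X (delta k) i) (ξ i)) =
      fun h => X (delta h) k * ξ h := by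
    funext h
    rw [← ContinuousLinearMap.star_eq_adjoint, star_apply_delta, RCLike.inner_apply, mul_comm]
    simp
  rwa [heq] at this

/-- The projection of `ℓ²(Γ)` onto the functions supported on `s`. -/
noncomputable def mask (s : Set Γ) : ell2 Γ →L[ℂ] ell2 Γ :=
  LinearMap.mkContinuous
    { toFun := fun ξ => ⟨s.indicator ξ, memℓp_two_of_sum_sq_le (C := ‖ξ‖ ^ 2) fun F =>
        (Finset.sum_le_sum fun k _ => by
          gcongr
          exact norm_indicator_le_norm_self _ _).trans (ell2_sum_sq_le ξ F)⟩
      map_add' := fun ξ η => by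
        ext k
        exact congrFun (Set.indicator_add s (ξ : Γ → ℂ) η) k
      map_smul' := fun c ξ => by
        ext k
        exact congrFun (Set.indicator_const_smul s c (ξ : Γ → ℂ)) k } 1
    fun ξ => by
      rw [one_mul]
      exact lp.norm_mono (by norm_num) fun k => norm_indicator_le_norm_self _ _

theorem mask_apply (s : Set Γ) (ξ : ell2 Γ) (k : Γ) : mask s ξ k = s.indicator ξ k := rfl

theorem mask_delta_of_mem {s : Set Γ} {g : Γ} (hg : g ∈ s) : mask s (delta g) = delta g := by
  ext k
  by_cases hk : k ∈ s
  · rw [mask_apply, Set.indicator_of_mem hk]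
  · rw [mask_apply, Set.indicator_of_notMem hk, delta_apply, if_neg]
    rintro rfl
    exact hk hg

theorem mask_delta_of_notMem {s : Set Γ} {g : Γ} (hg : g ∉ s) : mask s (delta g) = 0 := by
  ext k
  by_cases hk : k ∈ s
  · rw [mask_apply, Set.indicator_of_mem hk, delta_apply, if_neg]
    · rfl
    · rintro rfl
      exact hg hk
  · rw [mask_apply, Set.indicator_of_notMem hk]
    rfl

theorem norm_mask_le (s : Set Γ) (ξ : ell2 Γ) : ‖mask s ξ‖ ≤ ‖ξ‖ :=
  lp.norm_mono (by norm_num) fun _ => norm_indicator_le_norm_self _ _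

theorem sum_sq_norm_mask_fiber_le {Q : Type*} (π : Γ → Q) (ξ : ell2 Γ) (F : Finset Q) :
    ∑ q ∈ F, ‖mask (π ⁻¹' {q}) ξ‖ ^ 2 ≤ ‖ξ‖ ^ 2 := by
  classical
  refine hasSum_le (fun k => ?_)
    (hasSum_sum fun q (_ : q ∈ F) => ell2_hasSum_sq (mask (π ⁻¹' {q}) ξ)) (ell2_hasSum_sq ξ)
  have : ∀ q ∈ F, ‖mask (π ⁻¹' {q}) ξ k‖ ^ 2 = if π k = q then ‖ξ k‖ ^ 2 else 0 := by
    intro q _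
    rw [mask_apply, Set.indicator_apply]
    simp only [Set.mem_preimage, Set.mem_singleton_iff]
    split_ifs <;> simp
  rw [Finset.sum_congr rfl this, Finset.sum_ite_eq]
  split_ifs
  · exact le_rfl
  · positivity

/-- Group the coordinates by fiber, apply the operator norm bound to each block of `ξ`, and use that
the blocks are orthogonal. -/
theorem sum_sq_compress_le {Q : Type*} (π : Γ → Q) (X : ell2 Γ →L[ℂ] ell2 Γ) (ξ : ell2 Γ)
    (F : Finset Γ) :
    ∑ k ∈ F, ‖X (mask (π ⁻¹' {π k}) ξ) k‖ ^ 2 ≤ (‖X‖ * ‖ξ‖) ^ 2 := by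
  classical
  calc ∑ k ∈ F, ‖X (mask (π ⁻¹' {π k}) ξ) k‖ ^ 2
      = ∑ q ∈ F.image π, ∑ k ∈ F with π k = q, ‖X (mask (π ⁻¹' {π k}) ξ) k‖ ^ 2 :=
        (Finset.sum_fiberwise_of_maps_to (fun k hk => Finset.mem_image_of_mem π hk) _).symm
    _ ≤ ∑ q ∈ F.image π, (‖X‖ * ‖mask (π ⁻¹' {q}) ξ‖) ^ 2 := by
        refine Finset.sum_le_sum fun q _ => ?_
        calc ∑ k ∈ F with π k = q, ‖X (mask (π ⁻¹' {π k}) ξ) k‖ ^ 2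
            = ∑ k ∈ F with π k = q, ‖X (mask (π ⁻¹' {q}) ξ) k‖ ^ 2 :=
              Finset.sum_congr rfl fun k hk => by rw [(Finset.mem_filter.1 hk).2]
          _ ≤ ‖X (mask (π ⁻¹' {q}) ξ)‖ ^ 2 := ell2_sum_sq_le _ _
          _ ≤ _ := by
              gcongr
              exact X.le_opNorm _
    _ = ‖X‖ ^ 2 * ∑ q ∈ F.image π, ‖mask (π ⁻¹' {q}) ξ‖ ^ 2 := by
        rw [Finset.mul_sum]
        exact Finset.sum_congr rfl fun q _ => mul_pow _ _ _
    _ ≤ ‖X‖ ^ 2 * ‖ξ‖ ^ 2 := by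
        gcongr
        exact sum_sq_norm_mask_fiber_le π ξ _
    _ = _ := (mul_pow _ _ _).symm

/-- The block diagonal compression of `X` with respect to the partition of `Γ` into the fibers
of `π`. -/
noncomputable def compress {Q : Type*} (π : Γ → Q) (X : ell2 Γ →L[ℂ] ell2 Γ) :
    ell2 Γ →L[ℂ] ell2 Γ :=
  LinearMap.mkContinuous
    { toFun := fun ξ => ⟨fun k => X (mask (π ⁻¹' {π k}) ξ) k,
        memℓp_two_of_sum_sq_le (sum_sq_compress_le π X ξ)⟩
      map_add' := fun ξ η => by
        ext k
        change X (mask _ (ξ + η)) k = X (mask _ ξ) k + X (mask _ η) k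
        rw [map_add, map_add]
        rfl
      map_smul' := fun c ξ => by
        ext k
        change X (mask _ (c • ξ)) k = c • X (mask _ ξ) k
        rw [map_smul, map_smul]
        rfl } ‖X‖
    fun ξ => ell2_norm_le_of_sum_sq_le (by positivity) (sum_sq_compress_le π X ξ)

theorem compress_apply {Q : Type*} (π : Γ → Q) (X : ell2 Γ →L[ℂ] ell2 Γ) (ξ : ell2 Γ) (k : Γ) :
    compress π X ξ k = X (mask (π ⁻¹' {π k}) ξ) k := rfl

open Classical in
theorem compress_delta {Q : Type*} (π : Γ → Q) (X : ell2 Γ →L[ℂ] ell2 Γ) (h k : Γ) :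
    compress π X (delta h) k = if π h = π k then X (delta h) k else 0 := by
  rw [compress_apply]
  split_ifs with hp
  · rw [mask_delta_of_mem (show h ∈ π ⁻¹' {π k} from hp)]
  · rw [mask_delta_of_notMem (show h ∉ π ⁻¹' {π k} from hp), map_zero]
    rfl

end EllTwo

/-! ### Translations and convolution operators. -/

section Convolution

variable {Γ : Type*} [Group Γ]

theorem leftReg_delta (g h : Γ) : leftReg g (delta h) = delta (g * h) := by
  ext k
  exact delta_apply_congr inv_mul_eq_iff_eq_mul

theorem leftReg_mul (g h : Γ) : leftReg (g * h) = leftReg g * leftReg h := by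
  ext ξ k
  simp only [mul_apply_eq_comp, leftReg_apply, mul_inv_rev, mul_assoc]

theorem norm_leftReg_apply (g : Γ) (ξ : ell2 Γ) : ‖leftReg g ξ‖ = ‖ξ‖ :=
  (leftRegIsometry g).norm_map ξ

theorem star_leftReg (g : Γ) : star (leftReg g) = leftReg g⁻¹ := by
  refine clm_ext_delta fun h => ?_
  ext k
  rw [star_apply_delta, leftReg_delta, leftReg_delta, star_delta_apply]
  exact delta_apply_congr (by rw [eq_inv_mul_iff_mul_eq, eq_comm])

/-- The right regular representation of `Γ` as isometries, `(ρ(g) ξ)(h) = ξ(h g)`. -/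
noncomputable def rightRegIsometry (g : Γ) : ell2 Γ →ₗᵢ[ℂ] ell2 Γ where
  toFun ξ := ⟨fun h => ξ (h * g), (memℓp_gen_iff two_toReal_pos).2
    ((Equiv.mulRight g).summable_iff.2 ((memℓp_gen_iff two_toReal_pos).1 (lp.memℓp ξ)))⟩
  map_add' _ _ := by ext; rfl
  map_smul' _ _ := by ext; rfl
  norm_map' ξ := by
    rw [lp.norm_eq_tsum_rpow two_toReal_pos, lp.norm_eq_tsum_rpow two_toReal_pos]
    congr 1
    exact (Equiv.mulRight g).tsum_eq (fun h => ‖ξ h‖ ^ (2 : ℝ≥0∞).toReal)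

/-- The right regular representation of `Γ` on `ℓ²(Γ)`. -/
noncomputable def rightReg (g : Γ) : ell2 Γ →L[ℂ] ell2 Γ :=
  (rightRegIsometry g).toContinuousLinearMap

theorem rightReg_apply (g h : Γ) (ξ : ell2 Γ) : rightReg g ξ h = ξ (h * g) := rfl

theorem norm_rightReg_apply (g : Γ) (ξ : ell2 Γ) : ‖rightReg g ξ‖ = ‖ξ‖ :=
  (rightRegIsometry g).norm_map ξ

theorem rightReg_delta (g h : Γ) : rightReg g (delta h) = delta (h * g⁻¹) := by
  ext k
  exact delta_apply_congr eq_mul_inv_iff_mul_eq.symm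

theorem leftReg_mul_rightReg (g h : Γ) : leftReg g * rightReg h = rightReg h * leftReg g := by
  ext ξ k
  simp only [mul_apply_eq_comp, leftReg_apply, rightReg_apply, mul_assoc]

/-- `X` is left convolution by the vector `X δ₁`. -/
def IsConvolution (X : ell2 Γ →L[ℂ] ell2 Γ) : Prop :=
  ∀ h k, X (delta h) k = X (delta 1) (k * h⁻¹)

theorem IsConvolution.of_commute {X : ell2 Γ →L[ℂ] ell2 Γ}
    (h : ∀ g, X * rightReg g = rightReg g * X) : IsConvolution X := by
  intro a k
  have : X (delta a) = rightReg a⁻¹ (X (delta 1)) := by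
    rw [← mul_apply_eq_comp, ← h, mul_apply_eq_comp, rightReg_delta,
      inv_inv, one_mul]
  rw [this, rightReg_apply]

theorem IsConvolution.apply_delta {X : ell2 Γ →L[ℂ] ell2 Γ} (hX : IsConvolution X) (g : Γ) :
    X (delta g) = rightReg g⁻¹ (X (delta 1)) := by
  ext k
  rw [hX g k, rightReg_apply]

theorem IsConvolution.eq_of_apply_delta_one {X Y : ell2 Γ →L[ℂ] ell2 Γ} (hX : IsConvolution X)
    (hY : IsConvolution Y) (h : X (delta 1) = Y (delta 1)) : X = Y :=
  clm_ext_delta fun g => by rw [hX.apply_delta, hY.apply_delta, h]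

theorem IsConvolution.star_apply {X : ell2 Γ →L[ℂ] ell2 Γ} (hX : IsConvolution X) (k : Γ) :
    star X (delta 1) k = star (X (delta 1) k⁻¹) := by
  rw [star_apply_delta, hX k 1, one_mul]

theorem IsConvolution.norm_star_apply {X : ell2 Γ →L[ℂ] ell2 Γ} (hX : IsConvolution X) :
    ‖star X (delta 1)‖ = ‖X (delta 1)‖ := by
  have h1 := ell2_hasSum_sq (star X (delta 1))
  have h2 := (Equiv.inv Γ).hasSum_iff.2 (ell2_hasSum_sq (X (delta 1)))
  have h3 : ‖star X (delta 1)‖ ^ 2 = ‖X (delta 1)‖ ^ 2 := by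
    refine h1.unique ?_
    have heq : (fun k => ‖star X (delta 1) k‖ ^ 2) =
        (fun k => ‖X (delta 1) k‖ ^ 2) ∘ Equiv.inv Γ := by
      funext k
      rw [hX.star_apply, norm_star]
      rfl
    rwa [heq]
  exact (sq_eq_sq₀ (norm_nonneg _) (norm_nonneg _)).1 h3

/-- Left convolution operators supported on `s` commute with everything that commutes with `λ(g)`
for all `g ∈ s`. -/
theorem IsConvolution.commute_of_support {X T : ell2 Γ →L[ℂ] ell2 Γ} (hX : IsConvolution X)
    {s : Set Γ} (hs : ∀ g ∉ s, X (delta 1) g = 0)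
    (hT : ∀ g ∈ s, leftReg g * T = T * leftReg g) : T * X = X * T := by
  refine clm_ext_delta fun h => ?_
  ext m
  have h1 : HasSum (fun k => X (delta h) k * T (delta k) m) ((T * X) (delta h) m) := by
    have := hasSum_apply T (X (delta h)) m
    simp only [mul_comm (T _ _)] at this
    exact this
  have h2 : HasSum (fun j => X (delta j) m * T (delta h) j) ((X * T) (delta h) m) :=
    hasSum_apply X (T (delta h)) m
  -- With `j = h k⁻¹ m` one has `m j⁻¹ = k h⁻¹`, so this substitution matches the two matrix
  -- products term by term, and no approximation of `X` is needed.
  let e : Γ ≃ Γ := (Equiv.inv Γ).trans ((Equiv.mulLeft h).trans (Equiv.mulRight m))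
  refine h1.unique ?_
  convert e.hasSum_iff.2 h2 using 2 with k
  have he : e k = h * k⁻¹ * m := rfl
  simp only [Function.comp_apply]
  rw [hX h k, hX (e k) m, he]
  have hg : m * (h * k⁻¹ * m)⁻¹ = k * h⁻¹ := by group
  rw [hg]
  by_cases hk : k * h⁻¹ ∈ s
  · have : T (delta k) = leftReg (k * h⁻¹) (T (delta h)) := by
      rw [← mul_apply_eq_comp, hT _ hk, mul_apply_eq_comp, leftReg_delta,
        inv_mul_cancel_right]
    rw [this, leftReg_apply]
    simp
  · simp [hs _ hk]

end Convolution

/-! ### `L(Γ₀)` as an algebra of convolution operators; finiteness. -/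

section GroupVonNeumann

variable {Γ : Type*} [Group Γ]

theorem mem_subgroupVN_iff_commute {Γ₀ : Subgroup Γ} {X : ell2 Γ →L[ℂ] ell2 Γ} :
    X ∈ subgroupVN Γ₀ ↔
      ∀ T : ell2 Γ →L[ℂ] ell2 Γ, (∀ g ∈ Γ₀, leftReg g * T = T * leftReg g) → T * X = X * T := by
  have hc : ∀ T : ell2 Γ →L[ℂ] ell2 Γ,
      T ∈ StarSubalgebra.centralizer ℂ (leftReg '' (Γ₀ : Set Γ)) ↔
        ∀ g ∈ Γ₀, leftReg g * T = T * leftReg g := by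
    intro T
    rw [StarSubalgebra.mem_centralizer_iff]
    constructor
    · exact fun h g hg => (h _ ⟨g, hg, rfl⟩).1
    · rintro h _ ⟨g, hg, rfl⟩
      rw [star_leftReg]
      exact ⟨h g hg, h _ (inv_mem hg)⟩
  change X ∈ StarSubalgebra.centralizer ℂ
    (StarSubalgebra.centralizer ℂ (leftReg '' (Γ₀ : Set Γ)) : Set (ell2 Γ →L[ℂ] ell2 Γ)) ↔ _
  rw [StarSubalgebra.mem_centralizer_iff]
  constructor
  · exact fun h T hT => (h T ((hc T).2 hT)).1
  · intro h T hT
    exact ⟨h T ((hc T).1 hT), h _ ((hc _).1 (star_mem hT))⟩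

theorem leftReg_mul_mask {Γ₀ : Subgroup Γ} {a : Γ} (ha : a ∈ Γ₀) :
    leftReg a * mask (Γ₀ : Set Γ) = mask (Γ₀ : Set Γ) * leftReg a := by
  ext ξ k
  simp only [mul_apply_eq_comp, leftReg_apply, mask_apply]
  by_cases hk : k ∈ (Γ₀ : Set Γ)
  · rw [Set.indicator_of_mem (mul_mem (inv_mem ha) hk), Set.indicator_of_mem hk, leftReg_apply]
  · rw [Set.indicator_of_notMem hk, Set.indicator_of_notMem]
    exact fun hk' => hk ((Subgroup.mul_mem_cancel_left _ (inv_mem ha)).1 hk')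

/-- `L(Γ₀)` consists of the left convolution operators supported on `Γ₀`. -/
theorem mem_subgroupVN_iff {Γ₀ : Subgroup Γ} {X : ell2 Γ →L[ℂ] ell2 Γ} :
    X ∈ subgroupVN Γ₀ ↔ IsConvolution X ∧ ∀ g ∉ Γ₀, X (delta 1) g = 0 := by
  rw [mem_subgroupVN_iff_commute]
  constructor
  · intro h
    -- Two elements of the commutant of `λ(Γ₀)` suffice as tests: right translations give the
    -- convolution form, the projection onto `ℓ²(Γ₀)` gives the support.
    refine ⟨.of_commute fun g => (h _ fun a _ => leftReg_mul_rightReg a g).symm, fun g hg => ?_⟩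
    have hm := h (mask (Γ₀ : Set Γ)) fun a ha => leftReg_mul_mask ha
    have h1 := congrArg (fun T : ell2 Γ →L[ℂ] ell2 Γ => T (delta 1) g) hm
    simp only [mul_apply_eq_comp] at h1
    rw [mask_apply, Set.indicator_of_notMem hg, mask_delta_of_mem (one_mem Γ₀)] at h1
    exact h1.symm
  · rintro ⟨hX, hs⟩ T hT
    exact hX.commute_of_support (s := (Γ₀ : Set Γ)) hs hT

theorem groupVN_eq_subgroupVN_top : groupVN Γ = subgroupVN (⊤ : Subgroup Γ) := by
  rw [groupVN, subgroupVN, Subgroup.coe_top, Set.image_univ]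

theorem mem_groupVN_iff {X : ell2 Γ →L[ℂ] ell2 Γ} : X ∈ groupVN Γ ↔ IsConvolution X := by
  rw [groupVN_eq_subgroupVN_top, mem_subgroupVN_iff]
  simp

theorem leftReg_mem_groupVN (g : Γ) : leftReg g ∈ groupVN Γ :=
  subset_generatedVN _ ⟨g, rfl⟩

theorem canonicalTrace_apply (X : ell2 Γ →L[ℂ] ell2 Γ) :
    canonicalTrace X = X (delta 1) 1 :=
  inner_delta_left 1 (X (delta 1))

theorem twoNorm_canonicalTrace (X : ell2 Γ →L[ℂ] ell2 Γ) :
    twoNorm canonicalTrace X = ‖X (delta 1)‖ := by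
  have : canonicalTrace (star X * X) = ((‖X (delta 1)‖ ^ 2 : ℝ) : ℂ) := by
    change inner ℂ (delta 1) ((star X * X) (delta 1)) = _
    rw [mul_apply_eq_comp, ContinuousLinearMap.star_eq_adjoint,
      ContinuousLinearMap.adjoint_inner_right, inner_self_eq_norm_sq_to_K]
    norm_cast
  rw [twoNorm, this, Complex.ofReal_re, Real.sqrt_sq (norm_nonneg _)]

theorem IsConvolution.mul {X Y : ell2 Γ →L[ℂ] ell2 Γ} (hX : IsConvolution X)
    (hY : IsConvolution Y) : IsConvolution (X * Y) :=
  mem_groupVN_iff.1 (mul_mem (mem_groupVN_iff.2 hX) (mem_groupVN_iff.2 hY))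

theorem IsConvolution.star {X : ell2 Γ →L[ℂ] ell2 Γ} (hX : IsConvolution X) :
    IsConvolution (star X) :=
  mem_groupVN_iff.1 (star_mem (mem_groupVN_iff.2 hX))

theorem IsConvolution.smul {X : ell2 Γ →L[ℂ] ell2 Γ} (hX : IsConvolution X) (c : ℂ) :
    IsConvolution (c • X) :=
  fun h k => congrArg (c * ·) (hX h k)

/-- The trace property in the form `‖x u‖₂ = ‖x‖₂` for `u ∈ L(Γ)` unitary. -/
theorem IsConvolution.norm_mul_unitary {X U : ell2 Γ →L[ℂ] ell2 Γ} (hX : IsConvolution X)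
    (hU : IsConvolution U) (h : U * Star.star U = 1) :
    ‖(X * U) (delta 1)‖ = ‖X (delta 1)‖ := by
  rw [← (hX.mul hU).norm_star_apply, ← hX.norm_star_apply, star_mul, mul_apply_eq_comp]
  refine (ContinuousLinearMap.norm_map_iff_adjoint_comp_self (Star.star U)).2 ?_ _
  rw [← ContinuousLinearMap.star_eq_adjoint, star_star]
  exact h

/-- The trace property gives `‖v* δ₁‖ = ‖v δ₁‖ = 1`, so the unit vector `v v* δ₁` has inner product
`1` with `δ₁` and equals it; `δ₁` is separating. -/
theorem isFiniteVN_groupVN : IsFiniteVN (groupVN Γ) := by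
  intro v hv h
  have hv' := mem_groupVN_iff.1 hv
  have hq : IsConvolution (1 - v * star v) :=
    mem_groupVN_iff.1 (sub_mem (one_mem _) (mul_mem hv (star_mem hv)))
  have hn : ‖star v (delta 1)‖ = 1 := by
    rw [hv'.norm_star_apply, (ContinuousLinearMap.norm_map_iff_adjoint_comp_self v).2 h, norm_delta]
  have hz : (1 - v * star v) (delta 1) = 0 := by
    have hvn : ‖v (star v (delta 1))‖ = 1 := by
      rw [(ContinuousLinearMap.norm_map_iff_adjoint_comp_self v).2 h, hn]
    have hin : inner ℂ (delta 1) (v (star v (delta (1 : Γ)))) = (1 : ℂ) := by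
      rw [← ContinuousLinearMap.adjoint_inner_left, ← ContinuousLinearMap.star_eq_adjoint,
        inner_self_eq_norm_sq_to_K, hn]
      norm_num
    have := (inner_eq_one_iff_of_norm_eq_one (𝕜 := ℂ) (norm_delta (1 : Γ)) hvn).1 hin
    rw [sub_apply, mul_apply_eq_comp, ← this]
    simp
  have := hq.eq_of_apply_delta_one (Y := 0) (mem_groupVN_iff.1 (zero_mem _)) (by rw [hz]; rfl)
  exact (sub_eq_zero.1 this).symm

end GroupVonNeumann

/-! ### The ICC property and type II₁. -/

section Factor

variable {Γ : Type*} [Group Γ]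

theorem leftReg_apply_conj_invariant_iff (ξ : ell2 Γ) (g : Γ) :
    leftReg g (rightReg g ξ) = ξ ↔ ∀ h, ξ (g⁻¹ * h * g) = ξ h := by
  constructor
  · intro h k
    rw [← rightReg_apply, ← leftReg_apply, h]
  · intro h
    ext k
    rw [leftReg_apply, rightReg_apply, h]

theorem IsConvolution.conj_apply {X : ell2 Γ →L[ℂ] ell2 Γ} (hX : IsConvolution X) (g : Γ) :
    leftReg g (rightReg g (X (delta 1))) = leftReg g (X (leftReg g⁻¹ (delta 1))) := by
  rw [leftReg_delta, mul_one, hX.apply_delta g⁻¹, inv_inv]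

/-- In an ICC group, the only square summable class functions are the multiples of `δ₁`. -/
theorem eq_smul_delta_of_conj_invariant (hΓ : IsICC Γ) {ξ : ell2 Γ}
    (h : ∀ g, leftReg g (rightReg g ξ) = ξ) : ∃ c : ℂ, ξ = c • delta 1 := by
  refine ⟨ξ 1, ?_⟩
  ext k
  change ξ k = ξ 1 * delta 1 k
  by_cases hk : k = 1
  · simp [hk, delta_apply]
  · rw [delta_apply, if_neg hk, mul_zero]
    by_contra hne
    have hpos : 0 < ‖ξ k‖ := norm_pos_iff.2 hne
    -- A square summable function has modulus at least `‖ξ k‖` at finitely many points only, but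
    -- here on a whole conjugacy class.
    have hev := (ell2_tendsto_cofinite ξ).eventually (gt_mem_nhds hpos)
    rw [eventually_cofinite] at hev
    refine hΓ k hk (hev.subset ?_)
    rintro _ ⟨a, rfl⟩
    have := (leftReg_apply_conj_invariant_iff ξ a⁻¹).1 (h a⁻¹) k
    rw [inv_inv] at this
    simp [this]

theorem isFactor_groupVN (hΓ : IsICC Γ) : IsFactor (groupVN Γ) := by
  have hone : IsConvolution (1 : ell2 Γ →L[ℂ] ell2 Γ) := mem_groupVN_iff.1 (one_mem _)
  constructor
  · intro h
    have := norm_delta (1 : Γ)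
    rw [← one_apply_eq_self (F := ell2 Γ →L[ℂ] ell2 Γ) (delta (1 : Γ)), h] at this
    simp at this
  · intro z hz hc
    have hz' := mem_groupVN_iff.1 hz
    obtain ⟨c, hcz⟩ := eq_smul_delta_of_conj_invariant hΓ (ξ := z (delta 1)) fun g => by
      rw [hz'.conj_apply, ← mul_apply_eq_comp (leftReg g) z, ← hc _ (leftReg_mem_groupVN g),
        mul_apply_eq_comp, leftReg_delta, leftReg_delta, mul_one, mul_inv_cancel]
    exact ⟨c, hz'.eq_of_apply_delta_one (hone.smul c) hcz⟩

theorem IsConvolution.trace_mul_comm {X Y : ell2 Γ →L[ℂ] ell2 Γ} (hX : IsConvolution X)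
    (hY : IsConvolution Y) : (X * Y) (delta 1) 1 = (Y * X) (delta 1) 1 := by
  have h1 := hasSum_apply X (Y (delta 1)) 1
  have h2 := (Equiv.inv Γ).hasSum_iff.2 (hasSum_apply Y (X (delta 1)) 1)
  refine h1.unique ?_
  have heq : (fun h => X (delta h) 1 * Y (delta 1) h) =
      (fun h => Y (delta h) 1 * X (delta 1) h) ∘ Equiv.inv Γ := by
    funext h
    simp only [Function.comp_apply, Equiv.inv_apply]
    rw [hX h, hY h⁻¹]
    simp [mul_comm]
  rw [heq]
  exact h2

theorem inner_conj_left (g : Γ) (ξ η : ell2 Γ) :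
    inner ℂ (leftReg g (rightReg g ξ)) η = inner ℂ ξ (leftReg g⁻¹ (rightReg g⁻¹ η)) := by
  have h : η = leftReg g (rightReg g (leftReg g⁻¹ (rightReg g⁻¹ η))) := by
    ext k
    simp only [leftReg_apply, rightReg_apply]
    group
  conv_lhs => rw [h]
  exact ((leftRegIsometry g).inner_map_map _ _).trans ((rightRegIsometry g).inner_map_map _ _)

/-- In an ICC group, if `a λ(g) p λ(g)⁻¹ = p λ(g) a λ(g)⁻¹` for all `g` and `τ(p) ≠ 0`, then `a` is
a multiple of `p`: average the relation over the conjugates. -/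
theorem eq_smul_of_forall_conj (hΓ : IsICC Γ) {a p : ell2 Γ →L[ℂ] ell2 Γ}
    (ha : IsConvolution a) (hp : IsConvolution p) (hτ : p (delta 1) 1 ≠ 0)
    (h : ∀ g, a * leftReg g * p = p * leftReg g * a) : ∃ c : ℂ, a = c • p := by
  -- `W` is closed, invariant under diagonal conjugation, and contains `(p δ₁, a δ₁)` by `h`.
  -- Projecting the invariant vector `(δ₁, 0)` onto it plays the role of averaging.
  let W : Submodule ℂ (WithLp 2 (ell2 Γ × ell2 Γ)) :=
    { carrier := {v | ∀ g, a (leftReg g (rightReg g v.fst)) = p (leftReg g (rightReg g v.snd))}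
      add_mem' := fun {v w} hv hw g => by
        simp only [WithLp.add_fst, WithLp.add_snd, map_add, hv g, hw g]
      zero_mem' := fun g => by simp
      smul_mem' := fun c v hv g => by
        simp only [WithLp.smul_fst, WithLp.smul_snd, map_smul, hv g] }
  have hWmem : ∀ v, v ∈ W ↔
    ∀ g, a (leftReg g (rightReg g v.fst)) = p (leftReg g (rightReg g v.snd)) := fun _ => Iff.rfl
  have hWc : IsClosed (W : Set (WithLp 2 (ell2 Γ × ell2 Γ))) := by
    have : (W : Set (WithLp 2 (ell2 Γ × ell2 Γ))) =
        ⋂ g, {v | a (leftReg g (rightReg g v.fst)) = p (leftReg g (rightReg g v.snd))} := by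
      ext v
      simp [hWmem]
    rw [this]
    refine isClosed_iInter fun g => isClosed_eq ?_ ?_
    · have : Continuous fun v : WithLp 2 (ell2 Γ × ell2 Γ) => v.fst :=
        continuous_fst.comp (WithLp.prod_continuous_ofLp 2 _ _)
      fun_prop
    · have : Continuous fun v : WithLp 2 (ell2 Γ × ell2 Γ) => v.snd :=
        continuous_snd.comp (WithLp.prod_continuous_ofLp 2 _ _)
      fun_prop
  have : CompleteSpace W := hWc.completeSpace_coe
  let e : WithLp 2 (ell2 Γ × ell2 Γ) := WithLp.toLp 2 (delta 1, 0)
  let q := W.starProjection e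
  have hq : q ∈ W := Submodule.starProjection_apply_mem _ _
  have hort : ∀ w ∈ W, inner ℂ (delta 1 - q.fst) w.fst + inner ℂ (-q.snd) w.snd = 0 := by
    intro w hw
    have := W.starProjection_inner_eq_zero e w hw
    rw [WithLp.prod_inner_apply] at this
    simpa [e, q, inner_sub_left] using this
  -- Conjugation is unitary, preserves `W` and fixes `(δ₁, 0)`, so uniqueness of the projection
  -- makes `q` invariant.
  have hinv : ∀ g,
      WithLp.toLp 2 (leftReg g (rightReg g q.fst), leftReg g (rightReg g q.snd)) = q := by
    intro g
    refine (Submodule.eq_starProjection_of_mem_of_inner_eq_zero ?_ ?_).symm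
    · rw [hWmem]
      intro k
      have := (hWmem q).1 hq (k * g)
      have hk : ∀ ξ : ell2 Γ, leftReg k (rightReg k (leftReg g (rightReg g ξ))) =
          leftReg (k * g) (rightReg (k * g) ξ) := by
        intro ξ
        ext m
        simp only [leftReg_apply, rightReg_apply, mul_inv_rev, mul_assoc]
      exact (congrArg a (hk q.fst)).trans (this.trans (congrArg p (hk q.snd)).symm)
    · intro w hw
      have hmem : WithLp.toLp 2 (leftReg g⁻¹ (rightReg g⁻¹ w.fst),
          leftReg g⁻¹ (rightReg g⁻¹ w.snd)) ∈ W := by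
        rw [hWmem]
        intro k
        have := (hWmem w).1 hw (k * g⁻¹)
        have hk : ∀ ξ : ell2 Γ, leftReg k (rightReg k (leftReg g⁻¹ (rightReg g⁻¹ ξ))) =
            leftReg (k * g⁻¹) (rightReg (k * g⁻¹) ξ) := by
          intro ξ
          ext m
          simp only [leftReg_apply, rightReg_apply, mul_inv_rev, mul_assoc]
        exact (congrArg a (hk w.fst)).trans (this.trans (congrArg p (hk w.snd)).symm)
      have := hort _ hmem
      change inner ℂ (delta 1 - q.fst) (leftReg g⁻¹ (rightReg g⁻¹ w.fst)) +
        inner ℂ (-q.snd) (leftReg g⁻¹ (rightReg g⁻¹ w.snd)) = 0 at this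
      rw [← inner_conj_left, ← inner_conj_left, map_sub, map_sub, map_neg, map_neg,
        rightReg_delta, leftReg_delta, one_mul, mul_inv_cancel] at this
      rw [WithLp.prod_inner_apply, ← this, ← zero_sub (leftReg g (rightReg g q.snd))]
      rfl
  obtain ⟨α, hα⟩ := eq_smul_delta_of_conj_invariant hΓ (ξ := q.fst) fun g =>
    congrArg WithLp.fst (hinv g)
  obtain ⟨β, hβ⟩ := eq_smul_delta_of_conj_invariant hΓ (ξ := q.snd) fun g =>
    congrArg WithLp.snd (hinv g)
  have hrel : α • a (delta 1) = β • p (delta 1) := by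
    have := (hWmem q).1 hq 1
    simpa [hα, hβ, rightReg_delta, leftReg_delta] using this
  have hmem : WithLp.toLp 2 (p (delta 1), a (delta 1)) ∈ W := by
    rw [hWmem]
    intro g
    change a (leftReg g (rightReg g (p (delta 1)))) = p (leftReg g (rightReg g (a (delta 1))))
    rw [hp.conj_apply, ha.conj_apply]
    exact congrArg (fun T : ell2 Γ →L[ℂ] ell2 Γ => T (leftReg g⁻¹ (delta 1))) (h g)
  have h0 := hort _ hmem
  have hpne : p (delta 1) ≠ 0 := by
    intro h0
    rw [h0] at hτ
    exact hτ rfl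
  -- If `α = 0` then `β = 0` and `q = 0`, so `(δ₁, 0)` is orthogonal to `(p δ₁, a δ₁)`,
  -- contradicting `τ(p) ≠ 0`.
  have hα0 : α ≠ 0 := by
    rintro rfl
    rw [zero_smul, eq_comm, smul_eq_zero, or_iff_left hpne] at hrel
    simp [hα, hβ, hrel, inner_delta_left, hτ] at h0
  refine ⟨α⁻¹ * β, ha.eq_of_apply_delta_one (hp.smul _) ?_⟩
  change _ = (α⁻¹ * β) • p (delta 1)
  rw [mul_smul, ← hrel, inv_smul_smul₀ hα0]

/-- Put `ξ = p δ₁` and `r = τ(p) = ‖ξ‖²`. Since `p λ(g) p = c p`, taking traces gives `c r = star (ξ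
g)`, so `ξ` and its conjugate by `g` have inner product of modulus `‖ξ g‖² / r`, with total at most
`1` over `g`. The sum `σ` of the conjugates over a finite `F` thus satisfies `‖σ‖² ≤ |F|`, while its
coefficient at `1` is `|F| r`; hence `|F| ≤ 1 / r²` for every `F`. -/
theorem eq_zero_of_isAbelianProjection [Infinite Γ] (hΓ : IsICC Γ) {p : ell2 Γ →L[ℂ] ell2 Γ}
    (hp : IsAbelianProjection (groupVN Γ) p) : p = 0 := by
  obtain ⟨hpM, ⟨hpi, hps⟩, hab⟩ := hp
  have hpc := mem_groupVN_iff.1 hpM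
  have hpp : p * p = p := hpi
  have hsp : star p = p := hps
  by_contra hne
  set ξ := p (delta (1 : Γ)) with hξ
  set r := ‖ξ‖ ^ 2 with hr
  have hξ0 : ξ ≠ 0 := fun h0 => hne
    (hpc.eq_of_apply_delta_one (Y := 0) (mem_groupVN_iff.1 (zero_mem _)) h0)
  have hrpos : 0 < r := by
    have := norm_pos_iff.2 hξ0
    positivity
  have hin : ∀ η : ell2 Γ, inner ℂ ξ η = p η 1 := by
    intro η
    rw [hξ, ← ContinuousLinearMap.adjoint_inner_right, ← ContinuousLinearMap.star_eq_adjoint, hsp,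
      inner_delta_left]
  have hξ1 : ξ 1 = (r : ℂ) := by
    have := hin ξ
    rw [inner_self_eq_norm_sq_to_K, hξ, ← mul_apply_eq_comp, hpp] at this
    rw [hr]
    push_cast
    exact this.symm
  have hl := fun g : Γ => leftReg_mem_groupVN g
  have hc : ∀ g : Γ, ∃ c : ℂ, p * leftReg g * p = c • p := by
    intro g
    refine eq_smul_of_forall_conj hΓ
      (mem_groupVN_iff.1 (mul_mem (mul_mem hpM (hl g)) hpM)) hpc
      (by rw [← hξ, hξ1]; exact Complex.ofReal_ne_zero.2 hrpos.ne') fun k => ?_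
    have := hab _ (hl g) _ (hl k)
    simp only [mul_assoc] at this ⊢
    rw [← mul_assoc p p, hpp] at this
    rw [this, ← mul_assoc p p, hpp]
  have hf : ∀ g : Γ, ‖(inner ℂ ξ (leftReg g (rightReg g ξ)) : ℂ)‖ = ‖ξ g‖ ^ 2 / r := by
    intro g
    obtain ⟨c, hcg⟩ := hc g
    have h1 : inner ℂ ξ (leftReg g (rightReg g ξ)) = c * ξ g := by
      rw [hin, hξ, hpc.conj_apply]
      have := congrArg (fun T : ell2 Γ →L[ℂ] ell2 Γ => T (leftReg g⁻¹ (delta 1)) 1) hcg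
      refine this.trans ?_
      change c * p (leftReg g⁻¹ (delta 1)) 1 = _
      rw [leftReg_delta, hpc]
      simp
    have h2 : c * r = star (ξ g) := by
      have h3 := hpc.trace_mul_comm (mem_groupVN_iff.1 (mul_mem (hl g) hpM))
      rw [← mul_assoc, hcg, mul_assoc, hpp, mul_apply_eq_comp, leftReg_apply, mul_one] at h3
      have h4 := hpc.star_apply g
      rw [hsp] at h4
      rw [← hξ1, hξ, h4, star_star, ← h3]
      rfl
    have h5 : ‖c‖ * r = ‖ξ g‖ := by
      have := congrArg norm h2
      rwa [norm_mul, Complex.norm_of_nonneg hrpos.le, norm_star] at this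
    rw [h1, norm_mul, eq_div_iff hrpos.ne', mul_right_comm, h5, sq]
  have hcard : ∀ F : Finset Γ, (F.card : ℝ) * r ^ 2 ≤ 1 := by
    intro F
    rcases F.eq_empty_or_nonempty with rfl | hF
    · simp
    have hFpos : (0 : ℝ) < F.card := by exact_mod_cast hF.card_pos
    set σ := ∑ g ∈ F, leftReg g (rightReg g ξ) with hσ
    have hlow : (F.card : ℝ) * r ≤ ‖σ‖ := by
      have h1 : inner ℂ (delta 1) σ = ((F.card * r : ℝ) : ℂ) := by
        rw [hσ, inner_sum]
        simp only [inner_delta_left, leftReg_apply, rightReg_apply]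
        simp [hξ1]
      have h2 := norm_inner_le_norm (𝕜 := ℂ) (delta (1 : Γ)) σ
      rw [h1, norm_delta, one_mul, Complex.norm_of_nonneg (by positivity)] at h2
      exact h2
    have hup : ‖σ‖ ^ 2 ≤ F.card := by
      have h1 : (‖σ‖ ^ 2 : ℝ) ≤ ∑ g ∈ F, ∑ h ∈ F,
          ‖(inner ℂ (leftReg g (rightReg g ξ)) (leftReg h (rightReg h ξ)) : ℂ)‖ := by
        have h2 : ‖σ‖ ^ 2 = ‖(inner ℂ σ σ : ℂ)‖ := by
          rw [inner_self_eq_norm_sq_to_K]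
          simp
        rw [h2]
        conv_lhs => rw [hσ]
        rw [sum_inner]
        refine (norm_sum_le _ _).trans (Finset.sum_le_sum fun g _ => ?_)
        rw [inner_sum]
        exact norm_sum_le _ _
      refine h1.trans ?_
      have h3 : ∀ g ∈ F, ∑ h ∈ F,
          ‖(inner ℂ (leftReg g (rightReg g ξ)) (leftReg h (rightReg h ξ)) : ℂ)‖ ≤ 1 := by
        intro g _
        have h4 : ∀ h : Γ, ‖(inner ℂ (leftReg g (rightReg g ξ)) (leftReg h (rightReg h ξ)) : ℂ)‖ =
            ‖ξ (g⁻¹ * h)‖ ^ 2 / r := by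
          intro h
          rw [← hf, inner_conj_left]
          congr 2
          ext m
          simp only [leftReg_apply, rightReg_apply, mul_inv_rev, mul_assoc, inv_inv]
        simp only [h4]
        rw [← Finset.sum_div, div_le_one hrpos]
        exact ell2_sum_sq_le (leftReg g ξ) F |>.trans (by rw [norm_leftReg_apply])
      refine (Finset.sum_le_sum h3).trans ?_
      simp
    have h5 : ((F.card : ℝ) * r) ^ 2 ≤ F.card := (pow_le_pow_left₀ (by positivity) hlow 2).trans hup
    have h6 : (F.card : ℝ) * (F.card * r ^ 2) ≤ F.card * 1 := by
      rw [mul_one]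
      calc (F.card : ℝ) * (F.card * r ^ 2) = (F.card * r) ^ 2 := by ring
        _ ≤ _ := h5
    exact le_of_mul_le_mul_left h6 hFpos
  obtain ⟨n, hn⟩ := exists_nat_gt (1 / r ^ 2)
  obtain ⟨F, hF⟩ := Infinite.exists_subset_card_eq Γ n
  have := hcard F
  rw [hF] at this
  rw [div_lt_iff₀ (by positivity)] at hn
  linarith

theorem isTypeII₁Factor_groupVN [Infinite Γ] (hΓ : IsICC Γ) : IsTypeII₁Factor (groupVN Γ) :=
  ⟨isFactor_groupVN hΓ, isFiniteVN_groupVN, fun _ => eq_zero_of_isAbelianProjection hΓ⟩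

end Factor

/-! ### Strong convergence tested on the basis vectors. -/

section StrongConvergence

variable {Γ : Type*}

/-- A uniformly bounded family of operators that tends to `0` on every `δ_h` tends to `0`
strongly. -/
theorem tendsto_norm_apply_of_delta {ι : Type*} {l : Filter ι} (T : ι → ell2 Γ →L[ℂ] ell2 Γ)
    {C : ℝ} (hC : ∀ i ξ, ‖T i ξ‖ ≤ C * ‖ξ‖)
    (h : ∀ k, Tendsto (fun i => ‖T i (delta k)‖) l (𝓝 0)) (η : ell2 Γ) :
    Tendsto (fun i => ‖T i η‖) l (𝓝 0) := by
  rw [Metric.tendsto_nhds]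
  intro ε hε
  have hlim : Tendsto (fun F : Finset Γ => C * ‖η - ∑ k ∈ F, η k • delta k‖) atTop (𝓝 0) := by
    have h1 : Tendsto (fun F : Finset Γ => ∑ k ∈ F, η k • delta k) atTop (𝓝 η) :=
      hasSum_delta η
    have := ((tendsto_const_nhds (x := η)).sub h1).norm.const_mul C
    simpa using this
  obtain ⟨F, hF⟩ := (hlim.eventually (gt_mem_nhds (half_pos hε))).exists
  have hsum : Tendsto (fun i => ∑ k ∈ F, ‖η k‖ * ‖T i (delta k)‖) l (𝓝 0) := by
    have := tendsto_finsetSum F fun k _ => (h k).const_mul ‖η k‖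
    simpa using this
  filter_upwards [hsum.eventually (gt_mem_nhds (half_pos hε))] with i hi
  rw [dist_zero_right, norm_norm]
  have hdec : T i η = T i (η - ∑ k ∈ F, η k • delta k) + ∑ k ∈ F, η k • T i (delta k) := by
    rw [map_sub, map_sum]
    simp only [map_smul, sub_add_cancel]
  calc ‖T i η‖ ≤ ‖T i (η - ∑ k ∈ F, η k • delta k)‖ + ‖∑ k ∈ F, η k • T i (delta k)‖ := by
        rw [hdec]
        exact norm_add_le _ _
    _ ≤ C * ‖η - ∑ k ∈ F, η k • delta k‖ + ∑ k ∈ F, ‖η k‖ * ‖T i (delta k)‖ := by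
        refine add_le_add (hC _ _) ((norm_sum_le _ _).trans (le_of_eq ?_))
        simp only [norm_smul]
    _ < ε := by linarith

end StrongConvergence

/-! ### The conditional expectation and strong mixing from (ST). -/

section Mixing

variable {Γ : Type*} [Group Γ]

theorem mask_mul_of_mem_subgroupVN {Γ₀ : Subgroup Γ} {X : ell2 Γ →L[ℂ] ell2 Γ}
    (hX : X ∈ subgroupVN Γ₀) : mask (Γ₀ : Set Γ) * X = X * mask (Γ₀ : Set Γ) :=
  mem_subgroupVN_iff_commute.1 hX _ fun _ ha => leftReg_mul_mask ha

theorem subgroupVN_le_groupVN (Γ₀ : Subgroup Γ) : subgroupVN Γ₀ ≤ groupVN Γ :=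
  fun _ hX => mem_groupVN_iff.2 (mem_subgroupVN_iff.1 hX).1

theorem subgroupVN_commutative {Γ₀ : Subgroup Γ} (h : ∀ a ∈ Γ₀, ∀ b ∈ Γ₀, a * b = b * a) :
    ∀ a ∈ subgroupVN Γ₀, ∀ b ∈ subgroupVN Γ₀, a * b = b * a := by
  intro a ha b hb
  refine mem_subgroupVN_iff_commute.1 hb a fun g hg => ?_
  refine mem_subgroupVN_iff_commute.1 ha _ fun k hk => ?_
  rw [← leftReg_mul, ← leftReg_mul, h k hk g hg]

/-- The trace preserving conditional expectation of `L(Γ)` onto `L(Γ₀)`: the block diagonal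
compression with respect to the cosets `Γ₀ g`. -/
noncomputable def condExp (Γ₀ : Subgroup Γ) (X : ell2 Γ →L[ℂ] ell2 Γ) :
    ell2 Γ →L[ℂ] ell2 Γ :=
  compress (fun g => (Quotient.mk (QuotientGroup.rightRel Γ₀) g)) X

theorem mk_rightRel_eq_iff {Γ₀ : Subgroup Γ} {h k : Γ} :
    Quotient.mk (QuotientGroup.rightRel Γ₀) h = Quotient.mk (QuotientGroup.rightRel Γ₀) k ↔
      k * h⁻¹ ∈ Γ₀ := by
  rw [Quotient.eq, QuotientGroup.rightRel_apply]

theorem condExp_apply_of_mem (Γ₀ : Subgroup Γ) (X : ell2 Γ →L[ℂ] ell2 Γ) (ξ : ell2 Γ) {k : Γ}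
    (hk : k ∈ Γ₀) : condExp Γ₀ X ξ k = X (mask (Γ₀ : Set Γ) ξ) k := by
  have hfib : (fun g => Quotient.mk (QuotientGroup.rightRel Γ₀) g) ⁻¹'
      {Quotient.mk (QuotientGroup.rightRel Γ₀) k} = (Γ₀ : Set Γ) := by
    ext g
    rw [Set.mem_preimage, Set.mem_singleton_iff, eq_comm, mk_rightRel_eq_iff]
    exact Subgroup.mul_mem_cancel_right _ (inv_mem hk)
  rw [condExp, compress_apply, hfib]

/-- Whether `h` and `k` share a coset `Γ₀ g` depends only on `k h⁻¹`, so the compression is again a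
convolution, now supported on `Γ₀`. -/
theorem condExp_mem (Γ₀ : Subgroup Γ) {X : ell2 Γ →L[ℂ] ell2 Γ} (hX : IsConvolution X) :
    condExp Γ₀ X ∈ subgroupVN Γ₀ := by
  classical
  rw [mem_subgroupVN_iff]
  constructor
  · intro h k
    rw [condExp, compress_delta, compress_delta, hX h k]
    simp only [mk_rightRel_eq_iff, inv_one, mul_one]
  · intro g hg
    rw [condExp, compress_delta, if_neg]
    rwa [mk_rightRel_eq_iff, inv_one, mul_one]

theorem mask_eq_of_mem_subgroupVN {Γ₀ : Subgroup Γ} {X : ell2 Γ →L[ℂ] ell2 Γ}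
    (hX : X ∈ subgroupVN Γ₀) : mask (Γ₀ : Set Γ) (X (delta 1)) = X (delta 1) := by
  rw [← mul_apply_eq_comp, mask_mul_of_mem_subgroupVN hX, mul_apply_eq_comp,
    mask_delta_of_mem (one_mem Γ₀)]

theorem condExp_apply_delta_one {Γ₀ : Subgroup Γ} {X : ell2 Γ →L[ℂ] ell2 Γ}
    (hX : IsConvolution X) : condExp Γ₀ X (delta 1) = mask (Γ₀ : Set Γ) (X (delta 1)) := by
  ext k
  by_cases hk : k ∈ Γ₀
  · rw [condExp_apply_of_mem Γ₀ X _ hk, mask_delta_of_mem (one_mem Γ₀), mask_apply,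
      Set.indicator_of_mem (show k ∈ (Γ₀ : Set Γ) from hk)]
  · rw [(mem_subgroupVN_iff.1 (condExp_mem Γ₀ hX)).2 k hk, mask_apply,
      Set.indicator_of_notMem (show k ∉ (Γ₀ : Set Γ) from hk)]

theorem isCondExp_condExp (Γ₀ : Subgroup Γ) :
    IsCondExp canonicalTrace (groupVN Γ) (subgroupVN Γ₀) (condExp Γ₀) := by
  intro X hX
  refine ⟨condExp_mem Γ₀ (mem_groupVN_iff.1 hX), fun b hb => ?_⟩
  rw [canonicalTrace_apply, canonicalTrace_apply, mul_apply_eq_comp, mul_apply_eq_comp,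
    condExp_apply_of_mem Γ₀ X _ (one_mem Γ₀), mask_eq_of_mem_subgroupVN hb]

/-- (ST) covers only `h ∉ Γ₀`; for `h ∈ Γ₀` the set is empty because `g ∉ Γ₀`. -/
theorem ConditionST.finite {Γ₀ : Subgroup Γ} (hST : ConditionST Γ₀) {g : Γ} (hg : g ∉ Γ₀)
    (h : Γ) : {r | r ∈ Γ₀ ∧ g * r * h ∈ Γ₀}.Finite := by
  classical
  by_cases hh : h ∈ Γ₀
  · convert Set.finite_empty
    ext r
    simp only [Set.mem_ofPred_eq, Set.mem_empty_iff_false, iff_false, not_and]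
    intro hr hm
    exact hg ((Subgroup.mul_mem_cancel_right _ hr).1 ((Subgroup.mul_mem_cancel_right _ hh).1 hm))
  · obtain ⟨E, -, hE⟩ := hST {g, h} (by simp [hg, hh])
    refine E.finite_toSet.subset fun r hr => ?_
    by_contra hrE
    exact hE r hr.1 hrE g (by simp) h (by simp) hr.2

/-- Expand `λ(g) v δ_h` as the sum of `v(r) δ_{grh}` over `r ∈ Γ₀`; the projection keeps only the
terms with `g r h ∈ Γ₀`. -/
theorem norm_mask_leftReg_apply_le {Γ₀ : Subgroup Γ} {v : ell2 Γ →L[ℂ] ell2 Γ}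
    (hv : v ∈ subgroupVN Γ₀) (g h : Γ) {R : Finset Γ}
    (hR : ∀ r, r ∈ R ↔ r ∈ Γ₀ ∧ g * r * h ∈ Γ₀) :
    ‖mask (Γ₀ : Set Γ) (leftReg g (v (delta h)))‖ ≤ ∑ r ∈ R, ‖v (delta 1) r‖ := by
  classical
  obtain ⟨hvc, hv0⟩ := mem_subgroupVN_iff.1 hv
  have key : mask (Γ₀ : Set Γ) (leftReg g (v (delta h))) =
      ∑ r ∈ R, v (delta 1) r • delta (g * r * h) := by
    ext k
    have hgr : g * (g⁻¹ * k * h⁻¹) * h = k := by group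
    have hsum : (∑ r ∈ R, v (delta 1) r • delta (g * r * h) : ell2 Γ) k =
        if g⁻¹ * k * h⁻¹ ∈ R then v (delta 1) (g⁻¹ * k * h⁻¹) else 0 := by
      rw [lp.coeFn_sum, Finset.sum_apply, ← Finset.sum_ite_eq R (g⁻¹ * k * h⁻¹)]
      refine Finset.sum_congr rfl fun r _ => ?_
      change v (delta 1) r * delta (g * r * h) k = _
      have : k = g * r * h ↔ g⁻¹ * k * h⁻¹ = r := by
        rw [mul_inv_eq_iff_eq_mul, inv_mul_eq_iff_eq_mul, mul_assoc]
      rw [delta_apply, if_congr this rfl rfl]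
      split_ifs <;> simp
    rw [hsum]
    by_cases hk : k ∈ (Γ₀ : Set Γ)
    · rw [mask_apply, Set.indicator_of_mem hk, leftReg_apply, hvc h]
      split_ifs with hm
      · rfl
      · refine hv0 _ fun hm' => hm ((hR _).2 ⟨hm', ?_⟩)
        rwa [hgr]
    · rw [mask_apply, Set.indicator_of_notMem hk, if_neg]
      intro hm
      have := ((hR _).1 hm).2
      rw [hgr] at this
      exact hk this
  rw [key]
  refine (norm_sum_le _ _).trans (le_of_eq (Finset.sum_congr rfl fun r _ => ?_))
  rw [norm_smul, norm_delta, mul_one]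

/-- If `x ∈ L(Γ)` has vanishing expectation on `L(Γ₀)` and the unitaries `v i ∈ L(Γ₀)` tend weakly
to `0`, then the projections of `x (v i) η` to `ℓ²(Γ₀)` tend to `0`. -/
theorem ConditionST.tendsto_norm_mask {Γ₀ : Subgroup Γ} (hST : ConditionST Γ₀)
    {x : ell2 Γ →L[ℂ] ell2 Γ} (hx : IsConvolution x) (hx0 : ∀ g ∈ Γ₀, x (delta 1) g = 0)
    {ι : Type*} {l : Filter ι} (v : ι → ell2 Γ →L[ℂ] ell2 Γ) (hv : ∀ i, v i ∈ subgroupVN Γ₀)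
    (hv1 : ∀ i, star (v i) * v i = 1) (hv2 : ∀ i, v i * star (v i) = 1)
    (hlim : ∀ r, Tendsto (fun i => ‖v i (delta 1) r‖) l (𝓝 0)) (η : ell2 Γ) :
    Tendsto (fun i => ‖mask (Γ₀ : Set Γ) (x (v i η))‖) l (𝓝 0) := by
  have hiso : ∀ i ξ, ‖v i ξ‖ = ‖ξ‖ := fun i =>
    (ContinuousLinearMap.norm_map_iff_adjoint_comp_self (v i)).2 (hv1 i)
  -- The operators are bounded by `‖x‖` uniformly in `i`, so it suffices to treat `η = δ_h`.
  refine tendsto_norm_apply_of_delta (fun i => mask (Γ₀ : Set Γ) * x * v i) (C := ‖x‖)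
    (fun i ξ => ?_) (fun h => ?_) η
  · refine (norm_mask_le _ _).trans ((x.le_opNorm _).trans (le_of_eq ?_))
    exact congrArg (‖x‖ * ·) (hiso i ξ)
  have hterm : ∀ g, Tendsto
      (fun i => ‖x (delta 1) g‖ * ‖mask (Γ₀ : Set Γ) (leftReg g (v i (delta h)))‖) l (𝓝 0) := by
    intro g
    by_cases hg : g ∈ Γ₀
    · simpa [hx0 g hg] using tendsto_const_nhds
    · have hfin := hST.finite hg h
      have hb : Tendsto (fun i => ∑ r ∈ hfin.toFinset, ‖v i (delta 1) r‖) l (𝓝 0) := by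
        have := tendsto_finsetSum hfin.toFinset fun r _ => hlim r
        simpa using this
      have := squeeze_zero (fun i => norm_nonneg _)
        (fun i => norm_mask_leftReg_apply_le (hv i) g h (R := hfin.toFinset) (by simp)) hb
      simpa using this.const_mul ‖x (delta 1) g‖
  rw [Metric.tendsto_nhds]
  intro ε hε
  have hF : ∃ F : Finset Γ, ‖x (delta 1) - ∑ g ∈ F, x (delta 1) g • delta g‖ < ε / 2 := by
    have h1 : Tendsto (fun F : Finset Γ => ∑ g ∈ F, x (delta 1) g • delta g) atTop
        (𝓝 (x (delta 1))) := hasSum_delta _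
    have := ((tendsto_const_nhds (x := x (delta 1))).sub h1).norm
    rw [sub_self, norm_zero] at this
    exact (this.eventually (gt_mem_nhds (half_pos hε))).exists
  obtain ⟨F, hF⟩ := hF
  have hsum : Tendsto (fun i => ∑ g ∈ F,
      ‖x (delta 1) g‖ * ‖mask (Γ₀ : Set Γ) (leftReg g (v i (delta h)))‖) l (𝓝 0) := by
    have := tendsto_finsetSum F fun g _ => hterm g
    simpa using this
  filter_upwards [hsum.eventually (gt_mem_nhds (half_pos hε))] with i hi
  rw [dist_zero_right, norm_norm]
  set z : ell2 Γ →L[ℂ] ell2 Γ := ∑ g ∈ F, x (delta 1) g • leftReg g with hz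
  have hzc : IsConvolution (x - z) := by
    rw [← mem_groupVN_iff]
    exact sub_mem (mem_groupVN_iff.2 hx) (sum_mem fun g _ =>
      mem_groupVN_iff.2 ((mem_groupVN_iff.1 (leftReg_mem_groupVN g)).smul (x (delta 1) g)))
  have hvc := (mem_subgroupVN_iff.1 (hv i)).1
  -- The finite sum `z` approximates `x` only in the 2-norm. Right translation from `δ_h` to `δ₁`
  -- and `‖(x - z) v‖₂ = ‖x - z‖₂` make the error independent of `i`.
  have h1 : ‖(x - z) (v i (delta h))‖ < ε / 2 := by
    rw [← mul_apply_eq_comp, (hzc.mul hvc).apply_delta, norm_rightReg_apply,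
      hzc.norm_mul_unitary hvc (hv2 i)]
    refine lt_of_eq_of_lt ?_ hF
    rw [sub_apply, hz, sum_apply]
    simp only [smul_apply, leftReg_delta, mul_one]
  have hdec : mask (Γ₀ : Set Γ) (x (v i (delta h))) =
      mask (Γ₀ : Set Γ) ((x - z) (v i (delta h))) +
        ∑ g ∈ F, x (delta 1) g • mask (Γ₀ : Set Γ) (leftReg g (v i (delta h))) := by
    rw [sub_apply, map_sub, hz, sum_apply, map_sum]
    simp only [smul_apply, map_smul, sub_add_cancel]
  change ‖mask (Γ₀ : Set Γ) (x (v i (delta h)))‖ < ε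
  rw [hdec]
  have h2 : ‖∑ g ∈ F, x (delta 1) g • mask (Γ₀ : Set Γ) (leftReg g (v i (delta h)))‖ ≤
      ∑ g ∈ F, ‖x (delta 1) g‖ * ‖mask (Γ₀ : Set Γ) (leftReg g (v i (delta h)))‖ :=
    (norm_sum_le _ _).trans (le_of_eq (by simp only [norm_smul]))
  have h3 := norm_mask_le (Γ₀ : Set Γ) ((x - z) (v i (delta h)))
  have h4 := norm_add_le (mask (Γ₀ : Set Γ) ((x - z) (v i (delta h))))
    (∑ g ∈ F, x (delta 1) g • mask (Γ₀ : Set Γ) (leftReg g (v i (delta h))))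
  linarith

/-- If `Γ₀` is abelian and `(Γ, Γ₀)` satisfies condition (ST), then `L(Γ₀)` is strongly mixing in
`L(Γ)`. -/
theorem ConditionST.isStronglyMixing {Γ₀ : Subgroup Γ} (hST : ConditionST Γ₀)
    (hab : ∀ a ∈ Γ₀, ∀ b ∈ Γ₀, a * b = b * a) :
    IsStronglyMixing canonicalTrace (groupVN Γ) (subgroupVN Γ₀) := by
  have hcomm := subgroupVN_commutative hab
  refine ⟨subgroupVN_le_groupVN Γ₀, hcomm, condExp Γ₀, isCondExp_condExp Γ₀, ?_⟩
  intro G hG hao x hx y hy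
  have hxc := mem_groupVN_iff.1 hx
  have hyc := mem_groupVN_iff.1 hy
  have hex := condExp_mem Γ₀ hxc
  set w := x - condExp Γ₀ x with hw
  have hwc : IsConvolution w :=
    mem_groupVN_iff.1 (sub_mem hx (subgroupVN_le_groupVN Γ₀ hex))
  have hw0 : ∀ g ∈ Γ₀, w (delta 1) g = 0 := by
    intro g hg
    rw [hw, sub_apply, condExp_apply_delta_one hxc]
    change x (delta 1) g - mask (Γ₀ : Set Γ) (x (delta 1)) g = 0
    rw [mask_apply, Set.indicator_of_mem (show g ∈ (Γ₀ : Set Γ) from hg), sub_self]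
  have hlim : ∀ r, Tendsto (fun u : G => ‖star ((u : unitary (ell2 Γ →L[ℂ] ell2 Γ)) :
      ell2 Γ →L[ℂ] ell2 Γ) (delta 1) r‖) cofinite (𝓝 0) := by
    intro r
    rw [Metric.tendsto_nhds]
    intro ε hε
    -- `τ(u λ(r))` is the coefficient of `u` at `r⁻¹`, the conjugate of that of `u*` at `r`. Halving
    -- `ε` turns the non-strict bound into a strict one.
    have hfin := hao.2 _ (leftReg_mem_groupVN r) (ε / 2) (half_pos hε)
    rw [eventually_cofinite]
    refine (hfin.preimage (Subtype.val_injective.injOn (s := Set.univ) |>.mono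
      (Set.subset_univ _))).subset fun u hu => ⟨u.2, fun hle => hu ?_⟩
    rw [dist_zero_right, norm_norm]
    have huc := (mem_subgroupVN_iff.1 (hG u u.2)).1
    rw [canonicalTrace_apply, mul_apply_eq_comp, leftReg_delta, mul_one, huc r, one_mul] at hle
    rw [huc.star_apply, norm_star]
    linarith
  have hmain := hST.tendsto_norm_mask hwc hw0
    (fun u : G => star ((u : unitary (ell2 Γ →L[ℂ] ell2 Γ)) : ell2 Γ →L[ℂ] ell2 Γ))
    (fun u => star_mem (hG u u.2))
    (fun u => by rw [star_star]; exact Unitary.mul_star_self_of_mem u.1.2)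
    (fun u => by rw [star_star]; exact Unitary.star_mul_self_of_mem u.1.2) hlim
    (y (delta 1))
  refine hmain.congr fun u => ?_
  set U : ell2 Γ →L[ℂ] ell2 Γ := ((u : unitary (ell2 Γ →L[ℂ] ell2 Γ)) : ell2 Γ →L[ℂ] ell2 Γ)
    with hU
  have hUinv : (((u⁻¹ : G) : unitary (ell2 Γ →L[ℂ] ell2 Γ)) : ell2 Γ →L[ℂ] ell2 Γ) = star U := rfl
  have hUA : U ∈ subgroupVN Γ₀ := hG u u.2
  have hUM := subgroupVN_le_groupVN Γ₀ hUA
  have hU1 : star U * U = 1 := Unitary.star_mul_self_of_mem u.1.2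
  have hU2 : U * star U = 1 := Unitary.mul_star_self_of_mem u.1.2
  have hprod : IsConvolution (U * x * star U * y) :=
    mem_groupVN_iff.1 (mul_mem (mul_mem (mul_mem hUM hx) (star_mem hUM)) hy)
  have hE : condExp Γ₀ x = U * condExp Γ₀ x * star U := by
    rw [hcomm U hUA _ hex, mul_assoc, hU2, mul_one]
  -- `U` commutes with the projection onto `ℓ²(Γ₀)` and `E(x) = U E(x) U*`, so the difference
  -- factors through `w = x - E(x)`; the outer isometry `U` drops out of the norm.
  have hvec : (condExp Γ₀ (U * x * star U * y) - condExp Γ₀ x * condExp Γ₀ y) (delta 1) =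
      U (mask (Γ₀ : Set Γ) (w (star U (y (delta 1))))) := by
    have hm := fun ξ => congrArg (fun T : ell2 Γ →L[ℂ] ell2 Γ => T ξ)
      (mask_mul_of_mem_subgroupVN hUA)
    have hm' := fun ξ => congrArg (fun T : ell2 Γ →L[ℂ] ell2 Γ => T ξ)
      (mask_mul_of_mem_subgroupVN hex)
    simp only [mul_apply_eq_comp] at hm hm'
    rw [← hm, sub_apply, condExp_apply_delta_one hprod,
      mul_apply_eq_comp (condExp Γ₀ x), condExp_apply_delta_one hyc, ← hm']
    conv_lhs => rw [hE]
    simp only [mul_apply_eq_comp, hw, sub_apply, map_sub]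
  rw [hUinv, twoNorm_canonicalTrace, hvec,
    (ContinuousLinearMap.norm_map_iff_adjoint_comp_self U).2 hU1]

end Mixing

end HNNMixing

theorem corollary4p7 {Λ : Type*} [Group Λ] [Countable Λ] [Nontrivial Λ]
    (H K : Subgroup Λ) (φ : H ≃* K)
    (hφ : ∀ j : ℕ, 1 ≤ j → ∀ h : Λ, h ∈ HNNMixing.partialPow φ j h → h = 1) :
    HNNMixing.IsICC (HNNMixing.HNN φ) ∧
      HNNMixing.ConditionST (Subgroup.zpowers (HNNMixing.stableLetter φ)) ∧
      HNNMixing.IsTypeII₁Factor (HNNMixing.groupVN (HNNMixing.HNN φ)) ∧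
      HNNMixing.IsStronglyMixing HNNMixing.canonicalTrace
        (HNNMixing.groupVN (HNNMixing.HNN φ))
        (HNNMixing.subgroupVN (Subgroup.zpowers (HNNMixing.stableLetter φ))) := by
  have hICC := HNNMixing.isICC_HNN φ hφ
  have hST := HNNMixing.conditionST_zpowers_stableLetter φ hφ
  have : Infinite (HNNMixing.HNN φ) := by
    refine Infinite.of_injective (fun n : ℤ => HNNMixing.stableLetter φ ^ n) fun n m h => ?_
    have := congrArg (HNNMixing.exponentHom φ) h
    rw [HNNMixing.exponentHom_t_zpow, HNNMixing.exponentHom_t_zpow] at this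
    exact Multiplicative.ofAdd.injective this
  refine ⟨hICC, hST, HNNMixing.isTypeII₁Factor_groupVN hICC, hST.isStronglyMixing ?_⟩
  rintro _ ⟨n, rfl⟩ _ ⟨m, rfl⟩
  exact (Commute.refl _).zpow_zpow n m
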